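/- All schemes are of finite type over $\mathbb{C}$. For a scheme $W$ and $m \ge 0$, let $W_m$ denote the $m$-th jet scheme of $W$, that is, the scheme characterized by functorial bijections $\mathrm{Hom}_{\mathbb{C}}(\mathrm{Spec}\,A, W_m) \simeq \mathrm{Hom}_{\mathbb{C}}(\mathrm{Spec}\,A[t]/(t^{m+1}), W)$ for all $\mathbb{C}$-algebras $A$, and let $\rho_m^W : W_m \to W$ be the canonical projection, induced by $A[t]/(t^{m+1}) \to A$, $t \mapsto 0$. Let $\pi : \mathcal{W} \to S$ be a morphism of schemes over $\mathbb{C}$ and let $\tau : S \to \mathcal{W}$ be a section of $\pi$, i.e. $\pi \circ \tau = \mathrm{id}_S$. For a closed point $s \in S$ let $\mathcal{W}_s$ denote the fibre of $\pi$ over $s$, and regard $\tau(s)$ as a point of $\mathcal{W}_s$. Then for every $m \ge 1$ the function $$f(s) = \dim\, (\rho_m^{\mathcal{W}_s})^{-1}(\tau(s))$$ is upper semicontinuous on the set of closed points of $S$ (with the topology induced from $S$). -/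

import Mathlib

open CategoryTheory AlgebraicGeometry

noncomputable section

/-- The truncated polynomial ring `A[t]/(t^(m+1))`. -/
abbrev TruncPoly (A : Type*) [CommRing A] (m : ℕ) : Type _ :=
  Polynomial A ⧸ Ideal.span {(Polynomial.X : Polynomial A) ^ (m + 1)}

namespace TruncPoly

variable {A : Type*} [CommRing A] {m : ℕ}

lemma mk_eq_mk_iff (p q : Polynomial A) :
    (Ideal.Quotient.mk _ p : TruncPoly A m) = Ideal.Quotient.mk _ q ↔
      ∀ j < m + 1, p.coeff j = q.coeff j := by
  rw [Ideal.Quotient.eq, Ideal.mem_span_singleton, Polynomial.X_pow_dvd_iff]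
  simp [sub_eq_zero]

/-- The coefficient of `t^j` (meaningful for `j ≤ m`, and set to zero for `j > m`). -/
def coeff (j : ℕ) (x : TruncPoly A m) : A :=
  if j < m + 1 then (Quotient.out x : Polynomial A).coeff j else 0

lemma coeff_mk {j : ℕ} (hj : j < m + 1) (p : Polynomial A) :
    coeff j (Ideal.Quotient.mk _ p : TruncPoly A m) = p.coeff j := by
  rw [coeff, if_pos hj]
  refine (mk_eq_mk_iff _ _).1 ?_ j hj
  exact Quotient.out_eq (s := Submodule.quotientRel _) (Ideal.Quotient.mk _ p : TruncPoly A m)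

lemma ext_coeff {x y : TruncPoly A m} (h : ∀ j < m + 1, coeff j x = coeff j y) : x = y := by
  obtain ⟨p, rfl⟩ := Ideal.Quotient.mk_surjective x
  obtain ⟨q, rfl⟩ := Ideal.Quotient.mk_surjective y
  refine (mk_eq_mk_iff p q).2 fun j hj ↦ ?_
  simpa [coeff_mk hj] using h j hj

lemma coeff_add {j : ℕ} (hj : j < m + 1) (x y : TruncPoly A m) :
    coeff j (x + y) = coeff j x + coeff j y := by
  obtain ⟨p, rfl⟩ := Ideal.Quotient.mk_surjective x
  obtain ⟨q, rfl⟩ := Ideal.Quotient.mk_surjective y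
  rw [← map_add, coeff_mk hj, coeff_mk hj, coeff_mk hj, Polynomial.coeff_add]

lemma coeff_mul {j : ℕ} (hj : j < m + 1) (x y : TruncPoly A m) :
    coeff j (x * y) = ∑ p ∈ Finset.HasAntidiagonal.antidiagonal j, coeff p.1 x * coeff p.2 y := by
  obtain ⟨p, rfl⟩ := Ideal.Quotient.mk_surjective x
  obtain ⟨q, rfl⟩ := Ideal.Quotient.mk_surjective y
  rw [← map_mul, coeff_mk hj, Polynomial.coeff_mul]
  refine Finset.sum_congr rfl fun i hi ↦ ?_
  have := Finset.HasAntidiagonal.mem_antidiagonal.1 hi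
  rw [coeff_mk (by omega), coeff_mk (by omega)]

lemma coeff_algebraMap {k : Type*} [CommRing k] [Algebra k A] {j : ℕ} (hj : j < m + 1) (c : k) :
    coeff j (algebraMap k (TruncPoly A m) c) = if j = 0 then algebraMap k A c else 0 := by
  have : algebraMap k (TruncPoly A m) c =
    Ideal.Quotient.mk _ (Polynomial.C (algebraMap k A c)) := rfl
  rw [this, coeff_mk hj, Polynomial.coeff_C]

/-- The element `a 0 + a 1 t + ⋯ + a m t^m`. -/
def ofCoeff (a : ℕ → A) : TruncPoly A m :=
  Ideal.Quotient.mk _ (∑ i ∈ Finset.range (m + 1), Polynomial.monomial i (a i))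

lemma coeff_ofCoeff {j : ℕ} (hj : j < m + 1) (a : ℕ → A) :
    coeff j (ofCoeff a : TruncPoly A m) = a j := by
  rw [ofCoeff, coeff_mk hj]
  simp [Polynomial.finsetSum_coeff, Polynomial.coeff_monomial]
  omega

lemma isUnit_of_isUnit_coeff {x : TruncPoly A m} (h : IsUnit (coeff 0 x)) : IsUnit x := by
  obtain ⟨p, rfl⟩ := Ideal.Quotient.mk_surjective x
  rw [coeff_mk (by omega)] at h
  have hp : p = Polynomial.C (p.coeff 0) + Polynomial.X * p.divX := by
    conv_lhs => rw [← Polynomial.X_mul_divX_add p, add_comm]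
  rw [hp, map_add]
  refine IsNilpotent.isUnit_add_left_of_commute ⟨m + 1, ?_⟩ ?_ (Commute.all _ _)
  · rw [← map_pow, Ideal.Quotient.eq_zero_iff_mem, Ideal.mem_span_singleton, mul_pow]
    exact dvd_mul_right _ _
  · exact (h.map Polynomial.C).map _

lemma isUnit_coeff_of_isUnit {x : TruncPoly A m} (h : IsUnit x) : IsUnit (coeff 0 x) := by
  obtain ⟨y, hy⟩ := h.exists_right_inv
  refine IsUnit.of_mul_eq_one (coeff 0 y) ?_
  have h1 := coeff_mul (by omega : 0 < m + 1) x y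
  have h2 : coeff 0 (1 : TruncPoly A m) = 1 := by
    rw [← map_one (Ideal.Quotient.mk _), coeff_mk (by omega)]; simp
  rw [hy, h2] at h1
  simpa using h1.symm

end TruncPoly

namespace JetAlgebra
variable (k : Type*) [CommRing k] (R : Type*) [CommRing R] [Algebra k R] (m : ℕ)

/-- The variable `r⁽ʲ⁾` for `j ≤ m` (and zero for `j > m`). -/
def gen (r : R) (j : ℕ) : MvPolynomial (R × Fin (m + 1)) k :=
  if h : j < m + 1 then MvPolynomial.X (r, ⟨j, h⟩) else 0

/-- The relations saying that `r ↦ ∑ r⁽ʲ⁾ t^j` is a homomorphism of `k`-algebras modulo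
`t^(m+1)`. -/
inductive Rel : MvPolynomial (R × Fin (m + 1)) k → MvPolynomial (R × Fin (m + 1)) k → Prop
  | add (r s : R) (j : ℕ) (hj : j ≤ m) :
      Rel (gen k R m (r + s) j) (gen k R m r j + gen k R m s j)
  | mul (r s : R) (j : ℕ) (hj : j ≤ m) :
      Rel (gen k R m (r * s) j)
        (∑ p ∈ Finset.HasAntidiagonal.antidiagonal j, gen k R m r p.1 * gen k R m s p.2)
  | scalar (c : k) (j : ℕ) (hj : j ≤ m) :
      Rel (gen k R m (algebraMap k R c) j) (if j = 0 then MvPolynomial.C c else 0)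


end JetAlgebra

universe u

/-- The algebra of `m`-jets of the `k`-algebra `R`: it is generated over `k` by symbols `r⁽ʲ⁾`
(`r ∈ R`, `0 ≤ j ≤ m`), subject to the relations saying that `r ↦ ∑ r⁽ʲ⁾ t^j` is a homomorphism of
`k`-algebras modulo `t^(m+1)`.  It represents the functor `A ↦ Hom_k(R, A[t]/(t^(m+1)))`, see
`JetAlgebra.homEquiv`. -/
def JetAlgebra (k : Type u) [CommRing k] (R : Type u) [CommRing R] [Algebra k R] (m : ℕ) :
    Type u :=
  MvPolynomial (R × Fin (m + 1)) k ⧸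
    Ideal.span {x | ∃ p q, JetAlgebra.Rel k R m p q ∧ x = p - q}

namespace JetAlgebra

variable (k : Type u) [CommRing k] (R : Type u) [CommRing R] [Algebra k R] (m : ℕ)

instance : CommRing (JetAlgebra k R m) := inferInstanceAs (CommRing (_ ⧸ _))
instance : Algebra k (JetAlgebra k R m) := inferInstanceAs (Algebra k (_ ⧸ _))

/-- The quotient map from the polynomial ring on the symbols `r⁽ʲ⁾`. -/
def mk : MvPolynomial (R × Fin (m + 1)) k →ₐ[k] JetAlgebra k R m := Ideal.Quotient.mkₐ k _

lemma mk_surjective : Function.Surjective (mk k R m) := Ideal.Quotient.mkₐ_surjective k _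

lemma mk_eq_of_rel {p q : MvPolynomial (R × Fin (m + 1)) k} (h : Rel k R m p q) :
    mk k R m p = mk k R m q :=
  Ideal.Quotient.eq.2 (Ideal.subset_span ⟨p, q, h, rfl⟩)

variable {k R m} {A : Type*} [CommRing A] [Algebra k A]

/-- The element `r⁽ʲ⁾` of the jet algebra. -/
def D (j : ℕ) (r : R) : JetAlgebra k R m := mk k R m (gen k R m r j)

@[ext]
lemma algHom_ext {f g : JetAlgebra k R m →ₐ[k] A}
    (h : ∀ j < m + 1, ∀ r : R, f (D j r) = g (D j r)) : f = g := by
  have : f.comp (mk k R m) = g.comp (mk k R m) := by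
    refine MvPolynomial.algHom_ext fun ⟨r, j⟩ ↦ ?_
    have := h j j.2 r
    rwa [D, gen, dif_pos j.2] at this
  refine AlgHom.ext fun x ↦ ?_
  obtain ⟨p, rfl⟩ := mk_surjective k R m x
  exact congr($this p)

/-- The jet of `R` with values in `A` defined by a homomorphism from the jet algebra to `A`. -/
def toJet (f : JetAlgebra k R m →ₐ[k] A) : R →ₐ[k] TruncPoly A m where
  toFun r := TruncPoly.ofCoeff fun j ↦ f (D j r)
  map_one' := by
    refine TruncPoly.ext_coeff fun j hj ↦ ?_
    have := mk_eq_of_rel k R m (.scalar 1 j (by omega))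
    rw [map_one] at this
    rw [TruncPoly.coeff_ofCoeff hj, D, this]
    rw [← map_one (algebraMap k (TruncPoly A m)), TruncPoly.coeff_algebraMap hj]
    split_ifs <;> simp
  map_mul' r s := by
    refine TruncPoly.ext_coeff fun j hj ↦ ?_
    rw [TruncPoly.coeff_ofCoeff hj, TruncPoly.coeff_mul hj, D,
      mk_eq_of_rel k R m (.mul r s j (by omega)), map_sum, map_sum]
    refine Finset.sum_congr rfl fun p hp ↦ ?_
    have := Finset.HasAntidiagonal.mem_antidiagonal.1 hp
    rw [TruncPoly.coeff_ofCoeff (by omega), TruncPoly.coeff_ofCoeff (by omega), map_mul, map_mul]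
    rfl
  map_zero' := by
    refine TruncPoly.ext_coeff fun j hj ↦ ?_
    have := mk_eq_of_rel k R m (.scalar 0 j (by omega))
    rw [map_zero] at this
    rw [TruncPoly.coeff_ofCoeff hj, D, this]
    rw [← map_zero (algebraMap k (TruncPoly A m)), TruncPoly.coeff_algebraMap hj]
    split_ifs <;> simp
  map_add' r s := by
    refine TruncPoly.ext_coeff fun j hj ↦ ?_
    rw [TruncPoly.coeff_ofCoeff hj, TruncPoly.coeff_add hj, D,
      mk_eq_of_rel k R m (.add r s j (by omega)), map_add, map_add,
      TruncPoly.coeff_ofCoeff hj, TruncPoly.coeff_ofCoeff hj]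
    rfl
  commutes' c := by
    refine TruncPoly.ext_coeff fun j hj ↦ ?_
    rw [TruncPoly.coeff_ofCoeff hj, D, mk_eq_of_rel k R m (.scalar c j (by omega)),
      TruncPoly.coeff_algebraMap hj]
    split_ifs
    · rw [← MvPolynomial.algebraMap_eq, AlgHom.commutes, AlgHom.commutes]
    · simp

lemma coeff_toJet (f : JetAlgebra k R m →ₐ[k] A) {j : ℕ} (hj : j < m + 1) (r : R) :
    TruncPoly.coeff j (toJet f r) = f (D j r) :=
  TruncPoly.coeff_ofCoeff hj _

/-- The homomorphism from the jet algebra to `A` defined by a jet of `R` with values in `A`. -/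
def ofJet (g : R →ₐ[k] TruncPoly A m) : JetAlgebra k R m →ₐ[k] A :=
  Ideal.Quotient.liftₐ _ (MvPolynomial.aeval fun x ↦ TruncPoly.coeff x.2 (g x.1)) (by
    have key : ∀ (r : R) (j : ℕ), j < m + 1 →
        MvPolynomial.aeval (fun x : R × Fin (m + 1) ↦ TruncPoly.coeff x.2 (g x.1))
          (gen k R m r j) = TruncPoly.coeff j (g r) := by
      intro r j hj
      simp [gen, hj]
    intro a ha
    refine (Ideal.span_le (I := RingHom.ker (MvPolynomial.aeval (R := k)
      fun x : R × Fin (m + 1) ↦ TruncPoly.coeff x.2 (g x.1)))).2 ?_ ha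
    rintro _ ⟨p, q, h, rfl⟩
    rw [SetLike.mem_coe, RingHom.mem_ker, map_sub, sub_eq_zero]
    cases h with
    | add r s j hj =>
      rw [map_add, key _ _ (by omega), key _ _ (by omega), key _ _ (by omega), map_add,
        TruncPoly.coeff_add (by omega)]
    | mul r s j hj =>
      rw [map_sum, key _ _ (by omega), map_mul, TruncPoly.coeff_mul (by omega)]
      refine Finset.sum_congr rfl fun p hp ↦ ?_
      have := Finset.HasAntidiagonal.mem_antidiagonal.1 hp
      rw [map_mul, key _ _ (by omega), key _ _ (by omega)]
    | scalar c j hj =>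
      rw [key _ _ (by omega), AlgHom.commutes, TruncPoly.coeff_algebraMap (by omega)]
      split_ifs <;> simp)

lemma ofJet_D (g : R →ₐ[k] TruncPoly A m) {j : ℕ} (hj : j < m + 1) (r : R) :
    ofJet g (D j r) = TruncPoly.coeff j (g r) := by
  change MvPolynomial.aeval _ (gen k R m r j) = _
  simp [gen, hj]

variable (k R m A) in
/-- The universal property of the jet algebra. -/
def homEquiv : (JetAlgebra k R m →ₐ[k] A) ≃ (R →ₐ[k] TruncPoly A m) where
  toFun := toJet
  invFun := ofJet
  left_inv f := algHom_ext fun j hj r ↦ by rw [ofJet_D _ hj, coeff_toJet _ hj]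
  right_inv g := AlgHom.ext fun r ↦ TruncPoly.ext_coeff fun j hj ↦ by
    rw [coeff_toJet _ hj, ofJet_D _ hj]

variable (k R m) in
/-- The homomorphism `r ↦ r⁽⁰⁾`; it corresponds to sending a jet to its base point. -/
def base : R →ₐ[k] JetAlgebra k R m where
  toFun := D 0
  map_one' := by
    have := mk_eq_of_rel k R m (.scalar 1 0 (by omega))
    rw [map_one] at this
    simpa [D] using this
  map_mul' r s := by simpa [D] using mk_eq_of_rel k R m (.mul r s 0 (by omega))
  map_zero' := by
    have := mk_eq_of_rel k R m (.scalar 0 0 (by omega))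
    rw [map_zero] at this
    simpa [D] using this
  map_add' r s := by simpa [D] using mk_eq_of_rel k R m (.add r s 0 (by omega))
  commutes' c := by
    rw [D, mk_eq_of_rel k R m (.scalar c 0 (by omega)), if_pos rfl,
      ← MvPolynomial.algebraMap_eq, AlgHom.commutes]

variable {R' R'' : Type u} [CommRing R'] [Algebra k R'] [CommRing R''] [Algebra k R'']

variable (m) in
/-- The jet algebra is functorial in the algebra: `r⁽ʲ⁾ ↦ (h r)⁽ʲ⁾`. -/
def map (h : R →ₐ[k] R') : JetAlgebra k R m →ₐ[k] JetAlgebra k R' m :=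
  ofJet ((toJet (AlgHom.id k _)).comp h)

@[simp]
lemma map_D (h : R →ₐ[k] R') {j : ℕ} (hj : j < m + 1) (r : R) :
    map m h (D j r) = D j (h r) := by
  rw [map, ofJet_D _ hj, AlgHom.comp_apply, coeff_toJet _ hj, AlgHom.id_apply]

lemma map_id : map m (AlgHom.id k R) = AlgHom.id k _ :=
  algHom_ext fun j hj r ↦ by rw [map_D _ hj]; rfl

lemma map_comp (h : R →ₐ[k] R') (h' : R' →ₐ[k] R'') :
    map m (h'.comp h) = (map m h').comp (map m h) :=
  algHom_ext fun j hj r ↦ by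
    rw [map_D _ hj, AlgHom.comp_apply, AlgHom.comp_apply, map_D _ hj, map_D _ hj]

lemma map_base (h : R →ₐ[k] R') (r : R) : map m h (base k R m r) = base k R' m (h r) :=
  map_D _ (by omega) _

/-- Jet algebras are compatible with localization. -/
theorem isLocalization_map (h : R →ₐ[k] R') (f : R)
    (hf : letI := h.toRingHom.toAlgebra; IsLocalization.Away f R') :
    letI := (map m h).toRingHom.toAlgebra
    IsLocalization.Away (base k R m f) (JetAlgebra k R' m) := by
  let : Algebra R R' := h.toRingHom.toAlgebra
  let : Algebra (JetAlgebra k R m) (JetAlgebra k R' m) := (map m h).toRingHom.toAlgebra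
  have halg : ∀ x, algebraMap (JetAlgebra k R m) (JetAlgebra k R' m) x = map m h x := fun _ ↦ rfl
  let L := Localization.Away (base k R m f)
  let i : JetAlgebra k R m →ₐ[k] L := IsScalarTower.toAlgHom k _ _
  have hi : ∀ x, i x = algebraMap (JetAlgebra k R m) L x := fun _ ↦ rfl
  have hu : IsUnit (toJet i f) := by
    refine TruncPoly.isUnit_of_isUnit_coeff ?_
    rw [coeff_toJet _ (by omega)]
    exact IsLocalization.Away.algebraMap_isUnit (base k R m f)
  let g₀ : R' →+* TruncPoly L m := IsLocalization.Away.lift (g := (toJet i).toRingHom) f hu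
  have hg₀ : ∀ r, g₀ (h r) = toJet i r := fun r ↦ IsLocalization.Away.lift_eq f hu r
  let g : R' →ₐ[k] TruncPoly L m :=
    { g₀ with
      commutes' := fun c ↦ by
        have := hg₀ (algebraMap k R c)
        rwa [AlgHom.commutes, AlgHom.commutes] at this }
  let a : JetAlgebra k R' m →ₐ[k] L := ofJet g
  have ha : a.comp (map m h) = i := algHom_ext fun j hj r ↦ by
    rw [AlgHom.comp_apply, map_D _ hj, ofJet_D _ hj, ← coeff_toJet _ hj]
    exact congrArg _ (hg₀ r)
  have hv : IsUnit (map m h (base k R m f)) := by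
    rw [map_base]
    exact (IsLocalization.Away.algebraMap_isUnit (S := R') f).map (base k R' m)
  let b : L →+* JetAlgebra k R' m :=
    IsLocalization.Away.lift (g := (map m h).toRingHom) (base k R m f) hv
  have hb : ∀ x, b (i x) = map m h x := fun x ↦
    IsLocalization.Away.lift_eq (base k R m f) hv x
  let b' : L →ₐ[k] JetAlgebra k R' m :=
    { b with
      commutes' := fun c ↦ by
        have := hb (algebraMap k _ c)
        rwa [AlgHom.commutes, AlgHom.commutes] at this }
  have hab : ∀ x, a (b x) = x := by
    have : a.toRingHom.comp b = RingHom.id L := by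
      refine IsLocalization.ringHom_ext (.powers (base k R m f)) (RingHom.ext fun x ↦ ?_)
      change a (b (i x)) = i x
      rw [hb, ← ha]; rfl
    exact fun x ↦ congr($this x)
  have hba : ∀ x, b (a x) = x := by
    have : b'.comp a = AlgHom.id k _ := by
      refine (homEquiv k R' m _).injective ?_
      have : (toJet (b'.comp a)).toRingHom = (toJet (AlgHom.id k (JetAlgebra k R' m))).toRingHom := by
        refine IsLocalization.ringHom_ext (.powers f) (RingHom.ext fun r ↦ ?_)
        refine TruncPoly.ext_coeff fun j hj ↦ ?_
        change TruncPoly.coeff j (toJet (b'.comp a) (h r)) = TruncPoly.coeff j (toJet _ (h r))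
        rw [coeff_toJet _ hj, coeff_toJet _ hj, ← map_D _ hj]
        change b (a.comp (map m h) (D j r)) = _
        rw [ha, hb]; rfl
      exact AlgHom.ext fun x ↦ congr($this x)
    exact fun x ↦ congr($this x)
  refine IsLocalization.isLocalization_of_algEquiv (.powers (base k R m f)) (S := L)
    { toFun := b, invFun := a, left_inv := hab, right_inv := hba, map_mul' := map_mul b,
      map_add' := map_add b, commutes' := fun x ↦ hb x }

end JetAlgebra


namespace AlgebraicGeometry.Scheme

variable {k : Type u} [CommRing k] {W : Scheme.{u}} (p : W ⟶ Spec (.of k)) (m : ℕ)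

/-- The ring of sections over an open subset of a scheme over `k` is a `k`-algebra. -/
@[reducible]
def sectionsAlgebra (U : W.Opens) : Algebra k Γ(W, U) :=
  ((Scheme.ΓSpecIso (.of k)).inv ≫ p.appTop ≫ W.presheaf.map (homOfLE le_top).op).hom.toAlgebra

/-- Restriction of sections, as a homomorphism of `k`-algebras. -/
def sectionsRestrict {U V : W.Opens} (i : V ≤ U) :
    letI := sectionsAlgebra p U
    letI := sectionsAlgebra p V
    Γ(W, U) →ₐ[k] Γ(W, V) :=
  letI := sectionsAlgebra p U
  letI := sectionsAlgebra p V
  { (W.presheaf.map (homOfLE i).op).hom with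
    commutes' := fun c ↦ by
      have : ((Scheme.ΓSpecIso (.of k)).inv ≫ p.appTop ≫
          W.presheaf.map (homOfLE (le_top : U ≤ ⊤)).op) ≫ W.presheaf.map (homOfLE i).op =
          (Scheme.ΓSpecIso (.of k)).inv ≫ p.appTop ≫
            W.presheaf.map (homOfLE (le_top : V ≤ ⊤)).op := by
        simp only [Category.assoc, ← Functor.map_comp]
        rfl
      exact congr($(this).hom c) }

/-- The jet algebra of `𝒪_W(U)` over `k`, as a ring. -/
def jetSections (U : W.Opens) : CommRingCat.{u} :=
  letI := sectionsAlgebra p U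
  .of (JetAlgebra k Γ(W, U) m)

/-- The presheaf `U ↦ JetAlgebra k 𝒪_W(U) m` on affine open subsets. -/
def jetPresheaf : W.AffineZariskiSiteᵒᵖ ⥤ CommRingCat.{u} where
  obj U := jetSections p m U.unop.1
  map {U V} i :=
    letI := sectionsAlgebra p U.unop.1
    letI := sectionsAlgebra p V.unop.1
    CommRingCat.ofHom
      (JetAlgebra.map m (sectionsRestrict p (AffineZariskiSite.toOpens_mono i.unop.le))).toRingHom
  map_id U := by
    let := sectionsAlgebra p U.unop.1
    have : sectionsRestrict p (le_refl U.unop.1) = AlgHom.id k _ :=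
      AlgHom.ext fun x ↦ congr($(W.presheaf.map_id _).hom x)
    change CommRingCat.ofHom (JetAlgebra.map m (sectionsRestrict p le_rfl)).toRingHom = _
    rw [this, JetAlgebra.map_id]
    rfl
  map_comp {U V T} i j := by
    let := sectionsAlgebra p U.unop.1
    let := sectionsAlgebra p V.unop.1
    let := sectionsAlgebra p T.unop.1
    have hi := AffineZariskiSite.toOpens_mono i.unop.le
    have hj := AffineZariskiSite.toOpens_mono j.unop.le
    have : sectionsRestrict p (hj.trans hi) =
        (sectionsRestrict p hj).comp (sectionsRestrict p hi) :=
      AlgHom.ext fun x ↦ congr($(W.presheaf.map_comp (homOfLE hi).op (homOfLE hj).op).hom x)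
    change CommRingCat.ofHom (JetAlgebra.map m (sectionsRestrict p (hj.trans hi))).toRingHom = _
    rw [this, JetAlgebra.map_comp]
    rfl

/-- The structure map `𝒪_W(U) → JetAlgebra k 𝒪_W(U) m`, `r ↦ r⁽⁰⁾`. -/
def toJetPresheaf :
    (AffineZariskiSite.toOpensFunctor W).op ⋙ W.presheaf ⟶ jetPresheaf p m where
  app U :=
    letI := sectionsAlgebra p U.unop.1
    CommRingCat.ofHom (JetAlgebra.base k Γ(W, U.unop.1) m).toRingHom
  naturality U V i := by
    let := sectionsAlgebra p U.unop.1
    let := sectionsAlgebra p V.unop.1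
    ext x
    exact (JetAlgebra.map_base
      (sectionsRestrict p (AffineZariskiSite.toOpens_mono i.unop.le)) x).symm

lemma coequifibered_toJetPresheaf : (toJetPresheaf p m).Coequifibered := by
  refine AffineZariskiSite.coequifibered_iff_forall_isLocalizationAway.mpr fun U f ↦ ?_
  let := sectionsAlgebra p U.1
  let := sectionsAlgebra p (U.basicOpen f).1
  exact JetAlgebra.isLocalization_map
    (sectionsRestrict p (AffineZariskiSite.toOpens_mono (U.basicOpen_le f))) f
    (U.2.isLocalization_basicOpen f)

/-- The `m`-th jet scheme `W_m` of a scheme `W` over `k`: it is obtained by gluing the spectra of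
the jet algebras of `𝒪_W(U)`, where `U` ranges over the affine open subsets of `W`. -/
def jetScheme : Scheme.{u} :=
  (AffineZariskiSite.relativeGluingData (coequifibered_toJetPresheaf p m)).glued

/-- The projection `ρ_m : W_m ⟶ W`. -/
def jetProj : jetScheme p m ⟶ W :=
  (AffineZariskiSite.relativeGluingData (coequifibered_toJetPresheaf p m)).toBase

/-- For a section `τ` of `π : W ⟶ S`, the point `τ(s)` of the fibre `W_s`. -/
def sectionPoint {S W : Scheme.{u}} (π : W ⟶ S) (τ : S ⟶ W) (hτ : τ ≫ π = 𝟙 S) (s : S) :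
    π.fiber s :=
  (π.fiberHomeo s).symm ⟨τ s, by
    rw [Set.mem_preimage, Set.mem_singleton_iff, ← Scheme.Hom.comp_apply, hτ]
    rfl⟩

/-- The structure morphism to `Spec k` of the fibre `W_s` of a morphism `π : W ⟶ S` of schemes
over `k`, where `pS` is the structure morphism of `S`. -/
def fiberStructure {S W : Scheme.{u}} (pS : S ⟶ Spec (.of k)) (π : W ⟶ S) (s : S) :
    π.fiber s ⟶ Spec (.of k) :=
  π.fiberι s ≫ π ≫ pS

end AlgebraicGeometry.Scheme

end

/-! Near a closed point of S, shrink to affine opens V = Spec B and U = Spec R with τ(V) ⊆ U ⊆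
π⁻¹(V), so that τ becomes a B-algebra retraction e : R → B. Jets of U relative to V whose base point
lies on τ form Spec J, with J = `Based m e`. Its fibre over a maximal ideal has the dimension of the
jet fibre in the theorem: the residue field is ℂ and forming jets commutes with base change.

Rescaling the parameter of jets grades J, the element r⁽ʲ⁾ having weight j. On J the functions r⁽⁰⁾
become scalars e(r), so J is generated over B by finitely many elements x_i of positive weight. The
fibres are therefore cones, each with the constant jet as vertex, and semicontinuity holds on the
base instead of only on the source.

For this, fix p. Graded Noether normalization (`exists_parameters`) gives r = dim homogeneous
elements z_j of one common weight on the fibre over p, modulo which the x_i are nilpotent. Lift them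
to homogeneous c_j in J. The weight spaces of J/(c) are finite B-modules, so Nakayama
(`exists_smul_pow_eq_zero`) gives b ∈ 1 + p that kills a power of every x_i in J/(c). Over any
maximal q not containing b the x_i are then nilpotent modulo the c_j, so that fibre is integral over
a quotient of a polynomial ring in r variables (`isIntegral_of_pow_mem`) and has dimension at most
r.

The grading is encoded by an algebra homomorphism Φ : A → A[T]. Homogeneity of the generators is
enough to make the coefficient of T^n the projection to weight n, so no further coaction axioms are
imposed. -/

/-! ### Homogeneous elements for a map A → A[T] -/

open Polynomial in
/-- For a coaction `Φ : A → A[T]` of the multiplicative group, the element `a` is homogeneous of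
weight `n` if `Φ a = a T^n`. -/
def IsWeight {k A : Type*} [CommRing k] [CommRing A] [Algebra k A] (Φ : A →ₐ[k] A[X])
    (n : ℕ) (a : A) : Prop :=
  Φ a = monomial n a

namespace IsWeight

open Polynomial

variable {k A : Type*} [CommRing k] [CommRing A] [Algebra k A] {Φ : A →ₐ[k] A[X]} {n n' : ℕ}
  {a b : A}

lemma zero : IsWeight Φ n 0 := by simp [IsWeight]

lemma one : IsWeight Φ 0 1 := by simp [IsWeight]

lemma add (ha : IsWeight Φ n a) (hb : IsWeight Φ n b) : IsWeight Φ n (a + b) := by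
  rw [IsWeight] at *
  rw [map_add, ha, hb, map_add]

lemma smul (c : k) (ha : IsWeight Φ n a) : IsWeight Φ n (c • a) := by
  rw [IsWeight] at *
  rw [map_smul, ha, smul_monomial]

lemma mul (ha : IsWeight Φ n a) (hb : IsWeight Φ n' b) : IsWeight Φ (n + n') (a * b) := by
  rw [IsWeight] at *
  rw [map_mul, ha, hb, monomial_mul_monomial]

lemma pow (ha : IsWeight Φ n a) (e : ℕ) : IsWeight Φ (e * n) (a ^ e) := by
  rw [IsWeight] at *
  rw [map_pow, ha, monomial_pow, mul_comm]

lemma prod {ι : Type*} (s : Finset ι) {x : ι → A} {w : ι → ℕ}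
    (hx : ∀ i ∈ s, IsWeight Φ (w i) (x i)) : IsWeight Φ (∑ i ∈ s, w i) (∏ i ∈ s, x i) := by
  classical
  induction s using Finset.induction_on with
  | empty => simpa using one
  | insert i s hi ih =>
    rw [Finset.sum_insert hi, Finset.prod_insert hi]
    exact (hx i (by simp)).mul (ih fun j hj ↦ hx j (by simp [hj]))

variable (Φ n) in
/-- The submodule of homogeneous elements of weight `n`. -/
def submodule : Submodule k A where
  carrier := {a | IsWeight Φ n a}
  zero_mem' := zero
  add_mem' := add
  smul_mem' c _ := smul c

lemma mem_submodule : a ∈ submodule Φ n ↔ IsWeight Φ n a := Iff.rfl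

lemma coeff_eq_self (ha : IsWeight Φ n a) : (Φ a).coeff n = a := by
  rw [IsWeight] at ha
  rw [ha, coeff_monomial_same]

lemma coeff_mul (ha : IsWeight Φ n a) (b : A) (j : ℕ) :
    (Φ (b * a)).coeff (j + n) = (Φ b).coeff j * a := by
  rw [IsWeight] at ha
  rw [map_mul, ha, coeff_mul_monomial]

lemma coeff_mul_of_lt (ha : IsWeight Φ n a) (b : A) {j : ℕ} (hj : j < n) :
    (Φ (b * a)).coeff j = 0 := by
  rw [IsWeight] at ha
  rw [map_mul, ha, ← mul_one a, ← C_mul_monomial, ← mul_assoc, monomial_one_right_eq_X_pow,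
    coeff_mul_X_pow', if_neg (by omega)]

end IsWeight

/-! ### Weight spaces, graded Nakayama and a finiteness criterion -/

section Monomials

open Polynomial

variable {k A : Type*} [CommRing k] [CommRing A] [Algebra k A] {Φ : A →ₐ[k] A[X]}
  {ι : Type*} [Fintype ι] (x : ι → A) (w : ι → ℕ)

variable (k) in
/-- The span of the monomials of weight `n` in elements `x i` of weights `w i`. -/
def monomialSpan (n : ℕ) : Submodule k A :=
  Submodule.span k {a | ∃ e : ι → ℕ, ∑ i, e i * w i = n ∧ a = ∏ i, x i ^ e i}

variable {x w}

lemma finite_exponents (hw : ∀ i, 0 < w i) (n : ℕ) :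
    {e : ι → ℕ | ∑ i, e i * w i ≤ n}.Finite := by
  classical
  refine (Set.finite_Iic (fun _ : ι ↦ n)).subset fun e he i ↦ ?_
  have h1 : e i * w i ≤ ∑ i, e i * w i :=
    Finset.single_le_sum (f := fun i ↦ e i * w i) (fun _ _ ↦ Nat.zero_le _) (Finset.mem_univ i)
  exact (Nat.le_mul_of_pos_right _ (hw i)).trans (h1.trans he)

/-- Pigeonhole: if all exponents were below N, the weight would be at most N ∑ w. -/
lemma exists_le_exponent {N : ℕ} {e : ι → ℕ} (h : N * ∑ i, w i < ∑ i, e i * w i) :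
    ∃ i, N ≤ e i := by
  by_contra! H
  refine h.not_ge ?_
  rw [Finset.mul_sum]
  exact Finset.sum_le_sum fun i _ ↦ Nat.mul_le_mul_right _ (H i).le

/-- Positive weights leave finitely many monomials in each weight. This makes Nakayama applicable
weight by weight although A itself need not be a finite module. -/
lemma monomialSpan_fg (hw : ∀ i, 0 < w i) (n : ℕ) : (monomialSpan k x w n).FG := by
  refine Submodule.fg_span ?_
  refine ((finite_exponents hw n).image fun e ↦ ∏ i, x i ^ e i).subset ?_
  rintro _ ⟨e, he, rfl⟩
  exact ⟨e, he.le, rfl⟩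

lemma isWeight_prod_pow (hx : ∀ i, IsWeight Φ (w i) (x i)) (e : ι → ℕ) :
    IsWeight Φ (∑ i, e i * w i) (∏ i, x i ^ e i) :=
  IsWeight.prod _ fun i _ ↦ (hx i).pow _

lemma mem_span_prod_pow (hgen : Algebra.adjoin k (Set.range x) = ⊤) (a : A) :
    a ∈ Submodule.span k (Set.range fun e : ι → ℕ ↦ ∏ i, x i ^ e i) := by
  have : a ∈ Algebra.adjoin k (Set.range x) := by rw [hgen]; trivial
  rw [Algebra.adjoin_range_eq_range_aeval] at this
  obtain ⟨p, rfl⟩ := this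
  change MvPolynomial.aeval x p ∈ _
  rw [MvPolynomial.aeval_def, MvPolynomial.eval₂_eq']
  refine Submodule.sum_mem _ fun e _ ↦ ?_
  rw [← Algebra.smul_def]
  exact Submodule.smul_mem _ _ (Submodule.subset_span ⟨e, rfl⟩)

/-- The coefficient of T^n fixes monomials of weight n and kills all others, so it projects onto the
span of the former. -/
lemma coeff_mem_monomialSpan (hx : ∀ i, IsWeight Φ (w i) (x i))
    (hgen : Algebra.adjoin k (Set.range x) = ⊤) (a : A) (n : ℕ) :
    (Φ a).coeff n ∈ monomialSpan k x w n := by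
  have h := mem_span_prod_pow hgen a
  induction h using Submodule.span_induction with
  | mem a ha =>
    obtain ⟨e, rfl⟩ := ha
    have := isWeight_prod_pow hx e
    rw [IsWeight] at this
    simp only
    rw [this, coeff_monomial]
    split_ifs with h
    · exact Submodule.subset_span ⟨e, h, rfl⟩
    · exact zero_mem _
  | zero => simp
  | add a b _ _ ha hb => rw [map_add, coeff_add]; exact add_mem ha hb
  | smul c a _ ha => rw [map_smul, coeff_smul]; exact Submodule.smul_mem _ _ ha

lemma prod_pow_mem_of_le {T : Ideal A} {N : ℕ} (hT : ∀ i, x i ^ N ∈ T) {e : ι → ℕ}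
    (h : N * ∑ i, w i < ∑ i, e i * w i) : ∏ i, x i ^ e i ∈ T := by
  classical
  obtain ⟨i, hi⟩ := exists_le_exponent h
  exact T.mem_of_dvd ((pow_dvd_pow _ hi).trans (Finset.dvd_prod_of_mem _ (Finset.mem_univ i)))
    (hT i)

/-- Graded Nakayama: if the `x i` are nilpotent modulo `I A`, they are nilpotent after multiplying
by some `b ∈ 1 + I`. -/
lemma exists_smul_pow_eq_zero (hw : ∀ i, 0 < w i) (hx : ∀ i, IsWeight Φ (w i) (x i))
    (hgen : Algebra.adjoin k (Set.range x) = ⊤) (I : Ideal k) (N : ℕ)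
    (hN : ∀ i, x i ^ N ∈ I.map (algebraMap k A)) :
    ∃ b : k, b - 1 ∈ I ∧ ∃ N', ∀ i, b • x i ^ N' = 0 := by
  classical
  have hcoeff : ∀ a ∈ I.map (algebraMap k A), ∀ n, (Φ a).coeff n ∈ I • monomialSpan k x w n := by
    intro a ha n
    replace ha : a ∈ I • (⊤ : Submodule k A) := by rw [Ideal.smul_top_eq_map]; exact ha
    induction ha using Submodule.smul_induction_on' with
    | smul r hr a _ =>
      rw [map_smul, coeff_smul]
      exact Submodule.smul_mem_smul hr (coeff_mem_monomialSpan hx hgen a n)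
    | add a _ b _ ha hb => rw [map_add, coeff_add]; exact add_mem ha hb
  -- A monomial of such large weight contains some `x i ^ N`, hence lies in I A; projecting to its
  -- own weight places it in I times that weight space.
  have hle : ∀ n, N * ∑ i, w i < n → monomialSpan k x w n ≤ I • monomialSpan k x w n := by
    intro n hn
    refine Submodule.span_le.2 ?_
    rintro _ ⟨e, rfl, rfl⟩
    have := hcoeff _ (prod_pow_mem_of_le hN hn) (∑ i, e i * w i)
    rwa [(isWeight_prod_pow hx e).coeff_eq_self] at this
  let N' := N * ∑ i, w i + 1
  have key : ∀ i, ∃ b : k, b - 1 ∈ I ∧ b • x i ^ N' = 0 := by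
    intro i
    have hlt : N * ∑ i, w i < N' * w i :=
      (Nat.lt_succ_self _).trans_le (Nat.le_mul_of_pos_right _ (hw i))
    obtain ⟨b, hb, hb'⟩ := Submodule.exists_sub_one_mem_and_smul_eq_zero_of_fg_of_le_smul I
      (monomialSpan k x w (N' * w i)) (monomialSpan_fg hw _) (hle _ hlt)
    refine ⟨b, hb, hb' _ (Submodule.subset_span ⟨Pi.single i N', ?_, ?_⟩)⟩
    · rw [Finset.sum_eq_single i] <;> simp +contextual
    · rw [Finset.prod_eq_single i] <;> simp +contextual
  choose b hb hb' using key
  refine ⟨∏ i, b i, ?_, N', fun i ↦ ?_⟩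
  · rw [← Ideal.Quotient.eq, map_prod]
    refine (Finset.prod_eq_one fun i _ ↦ ?_).trans (map_one _).symm
    rw [← map_one (Ideal.Quotient.mk I)]
    exact Ideal.Quotient.eq.2 (hb i)
  · rw [← Finset.prod_erase_mul _ _ (Finset.mem_univ i), mul_smul, hb', smul_zero]

/-- If the generators are nilpotent modulo homogeneous elements `z j` of positive weight, then the
algebra is finite over the subalgebra generated by the `z j`. -/
lemma isIntegral_of_pow_mem (hw : ∀ i, 0 < w i) (hx : ∀ i, IsWeight Φ (w i) (x i))
    (hgen : Algebra.adjoin k (Set.range x) = ⊤) {r : ℕ} (z : Fin r → A) {L : ℕ} (hL : 0 < L)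
    (hz : ∀ j, IsWeight Φ L (z j)) (N : ℕ)
    (hN : ∀ i, x i ^ N ∈ Ideal.span (Set.range z)) :
    Algebra.IsIntegral (Algebra.adjoin k (Set.range z)) A := by
  classical
  let C := Algebra.adjoin k (Set.range z)
  let S : Set A := (fun e : ι → ℕ ↦ ∏ i, x i ^ e i) '' {e | ∑ i, e i * w i ≤ N * ∑ i, w i}
  have hS : S.Finite := (finite_exponents hw _).image _
  let E : Submodule C A := Submodule.span C S
  -- Induction on the weight: a monomial of large weight n is ∑ c_j z_j, and its part of weight n is
  -- ∑ (c_j)_{n-L} z_j, where n - L < n because L > 0.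
  have hmem : ∀ n, monomialSpan k x w n ≤ E.restrictScalars k := by
    intro n
    induction n using Nat.strong_induction_on with
    | h n ih =>
    refine Submodule.span_le.2 ?_
    rintro _ ⟨e, rfl, rfl⟩
    rw [SetLike.mem_coe, Submodule.restrictScalars_mem]
    by_cases he : ∑ i, e i * w i ≤ N * ∑ i, w i
    · exact Submodule.subset_span ⟨e, he, rfl⟩
    · have h1 := prod_pow_mem_of_le hN (not_le.1 he)
      obtain ⟨c, hc⟩ := (Submodule.mem_span_range_iff_exists_fun A).1 h1
      rw [← (isWeight_prod_pow hx e).coeff_eq_self, ← hc, map_sum, finsetSum_coeff]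
      refine Submodule.sum_mem _ fun j _ ↦ ?_
      rw [smul_eq_mul]
      by_cases hlt : ∑ i, e i * w i < L
      · rw [(hz j).coeff_mul_of_lt _ hlt]; exact zero_mem _
      · obtain ⟨n', hn'⟩ := Nat.exists_eq_add_of_le' (not_lt.1 hlt)
        rw [hn', (hz j).coeff_mul, mul_comm]
        have := ih n' (by omega) (coeff_mem_monomialSpan hx hgen (c j) n')
        exact E.smul_mem (⟨z j, Algebra.subset_adjoin ⟨j, rfl⟩⟩ : C) this
  have htop : E = ⊤ := by
    rw [eq_top_iff]
    rintro a -
    have : Submodule.span k (Set.range fun e : ι → ℕ ↦ ∏ i, x i ^ e i) ≤ E.restrictScalars k := by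
      refine Submodule.span_le.2 ?_
      rintro _ ⟨e, rfl⟩
      exact hmem _ (Submodule.subset_span ⟨e, rfl, rfl⟩)
    exact this (mem_span_prod_pow hgen a)
  have : Module.Finite C A := ⟨htop ▸ Submodule.fg_span hS⟩
  exact Algebra.IsIntegral.of_finite C A

end Monomials

/-! ### Passing to quotients by homogeneous ideals -/

section Descent

open Polynomial

variable {k A : Type*} [CommRing k] [CommRing A] [Algebra k A]

/-- The coaction induced on the quotient by an invariant ideal. -/
noncomputable def quotientCoaction (Φ : A →ₐ[k] A[X]) (I : Ideal A)
    (hI : ∀ a ∈ I, (Φ a).map (Ideal.Quotient.mk I) = 0) : (A ⧸ I) →ₐ[k] (A ⧸ I)[X] :=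
  Ideal.Quotient.liftₐ I ((mapAlgHom (Ideal.Quotient.mkₐ k I)).comp Φ) hI

lemma IsWeight.quotient {Φ : A →ₐ[k] A[X]} {I : Ideal A}
    (hI : ∀ a ∈ I, (Φ a).map (Ideal.Quotient.mk I) = 0) {n : ℕ} {a : A} (ha : IsWeight Φ n a) :
    IsWeight (quotientCoaction Φ I hI) n (Ideal.Quotient.mk I a) := by
  rw [IsWeight] at *
  change (Φ a).map (Ideal.Quotient.mk I) = _
  rw [ha, map_monomial]

lemma map_eq_zero_of_mem_span {Φ : A →ₐ[k] A[X]} {s : Set A} (hs : ∀ a ∈ s, ∃ n, IsWeight Φ n a)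
    {a : A} (ha : a ∈ Ideal.span s) :
    (Φ a).map (Ideal.Quotient.mk (Ideal.span s)) = 0 := by
  have : Ideal.span s ≤
      RingHom.ker ((mapRingHom (Ideal.Quotient.mk (Ideal.span s))).comp Φ.toRingHom) := by
    refine Ideal.span_le.2 fun b hb ↦ ?_
    obtain ⟨n, hn⟩ := hs b hb
    rw [IsWeight] at hn
    change (Φ b).map _ = 0
    rw [hn, map_monomial, Ideal.Quotient.eq_zero_iff_mem.2 (Ideal.subset_span hb), map_zero]
  exact this ha

lemma map_eq_zero_of_mem_map (Φ : A →ₐ[k] A[X]) (I : Ideal k) {a : A}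
    (ha : a ∈ I.map (algebraMap k A)) :
    (Φ a).map (Ideal.Quotient.mk (I.map (algebraMap k A))) = 0 := by
  refine map_eq_zero_of_mem_span ?_ ha
  rintro _ ⟨c, _, rfl⟩
  refine ⟨0, ?_⟩
  rw [IsWeight, AlgHom.commutes, monomial_zero_left]
  rfl

end Descent

/-! ### Krull dimension and integral extensions -/

section IntegralDimension

/-- Incomparability: contraction of primes is strictly monotone. -/
lemma ringKrullDim_le_of_isIntegral (C A : Type*) [CommRing C] [CommRing A] [Algebra C A]
    [Algebra.IsIntegral C A] : ringKrullDim A ≤ ringKrullDim C :=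
  Order.krullDim_le_of_strictMono (PrimeSpectrum.comap (algebraMap C A)) fun _ _ h ↦
    Ideal.IsIntegral.comap_lt_comap h

/-- A chain of primes of C lifts to A: lying over, from injectivity, lifts its smallest member, and
going up lifts the rest. -/
lemma ringKrullDim_eq_of_isIntegral_of_injective (C A : Type*) [CommRing C] [CommRing A]
    [Algebra C A] [Algebra.IsIntegral C A] (h : Function.Injective (algebraMap C A)) :
    ringKrullDim A = ringKrullDim C := by
  refine (ringKrullDim_le_of_isIntegral C A).antisymm (iSup_le fun l ↦ ?_)
  obtain ⟨P, -, hP, hP'⟩ := Ideal.exists_ideal_over_prime_of_isIntegral (S := A)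
    l.head.asIdeal ⊥ (by
      rw [← RingHom.ker_eq_comap_bot, (RingHom.injective_iff_ker_eq_bot _).1 h]
      exact bot_le)
  have : P.LiesOver l.head.asIdeal := ⟨hP'.symm⟩
  obtain ⟨l', hl, -⟩ := Ideal.exists_ltSeries_of_hasGoingUp l P
  rw [← hl]
  exact Order.LTSeries.length_le_krullDim l'

variable {K A : Type*} [Field K] [CommRing A] [Algebra K A] {r : ℕ} (z : Fin r → A)

lemma ringKrullDim_le_of_isIntegral_adjoin [Algebra.IsIntegral (Algebra.adjoin K (Set.range z)) A] :
    ringKrullDim A ≤ r := by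
  refine (ringKrullDim_le_of_isIntegral (Algebra.adjoin K (Set.range z)) A).trans ?_
  have h : Function.Surjective ((MvPolynomial.aeval (R := K) z).rangeRestrict) :=
    AlgHom.rangeRestrict_surjective _
  rw [Algebra.adjoin_range_eq_range_aeval]
  refine (ringKrullDim_le_of_surjective
    ((MvPolynomial.aeval (R := K) z).rangeRestrict).toRingHom h).trans ?_
  simp [ringKrullDim_eq_zero_of_field]

lemma AlgebraicIndependent.ringKrullDim_eq_of_isIntegral_adjoin
    [Algebra.IsIntegral (Algebra.adjoin K (Set.range z)) A] (hz : AlgebraicIndependent K z) :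
    ringKrullDim A = r := by
  rw [ringKrullDim_eq_of_isIntegral_of_injective (Algebra.adjoin K (Set.range z)) A
    Subtype.val_injective, ← ringKrullDim_eq_of_ringEquiv hz.aevalEquiv.toRingEquiv]
  simp [ringKrullDim_eq_zero_of_field]

end IntegralDimension

/-- Integrality over a subalgebra `D` implies integrality over a subalgebra `C` over which the
generators of `D` are integral. -/
lemma Algebra.IsIntegral.of_adjoin {K A : Type*} [CommRing K] [CommRing A] [Algebra K A] (s : Set A)
    [Algebra.IsIntegral (Algebra.adjoin K s) A] (C : Subalgebra K A)
    (h : ∀ a ∈ s, IsIntegral C a) : Algebra.IsIntegral C A := by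
  let E := integralClosure C A
  have hle : Algebra.adjoin K s ≤ E.restrictScalars K := Algebra.adjoin_le h
  refine ⟨fun a ↦ ?_⟩
  refine isIntegral_trans (A := E) a ?_
  exact IsIntegral.map_of_comp_eq (Subalgebra.inclusion hle).toRingHom (RingHom.id A) rfl
    (Algebra.IsIntegral.isIntegral (R := Algebra.adjoin K s) a)

/-! ### Homogeneous polynomials restricted to a line -/

section Line

open Polynomial

namespace MvPolynomial.IsHomogeneous

lemma sum_exponents {K ι : Type*} [CommRing K] [Fintype ι] {F : MvPolynomial ι K} {d : ℕ}
    (hF : F.IsHomogeneous d) {e : ι →₀ ℕ} (he : e ∈ F.support) : ∑ i, e i = d := by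
  have := hF (MvPolynomial.mem_support_iff.1 he)
  rw [Finsupp.weight_apply, Finsupp.sum_fintype _ _ (by simp)] at this
  simpa using this

lemma eval_mul {K ι : Type*} [CommRing K] [Fintype ι] {F : MvPolynomial ι K} {d : ℕ}
    (hF : F.IsHomogeneous d) (t : K) (b : ι → K) :
    MvPolynomial.eval (fun i ↦ t * b i) F = t ^ d * MvPolynomial.eval b F := by
  rw [MvPolynomial.eval_eq', MvPolynomial.eval_eq', Finset.mul_sum]
  refine Finset.sum_congr rfl fun e he ↦ ?_
  simp only [mul_pow, Finset.prod_mul_distrib, Finset.prod_pow_eq_pow_sum, hF.sum_exponents he]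
  ring

/-- The restriction of a homogeneous polynomial to a line. -/
lemma natDegree_line_le_and_coeff {K R ι : Type*} [CommRing K]
    [CommRing R] [Algebra K R] [Fintype ι] {F : MvPolynomial ι K} {d : ℕ} (hF : F.IsHomogeneous d)
    (a b : ι → R) :
    (MvPolynomial.aeval
        (fun i ↦ Polynomial.C (a i) + Polynomial.C (b i) * Polynomial.X) F).natDegree ≤ d ∧
      (MvPolynomial.aeval
        (fun i ↦ Polynomial.C (a i) + Polynomial.C (b i) * Polynomial.X) F).coeff d =
        MvPolynomial.aeval b F := by
  have hlin : ∀ i, (Polynomial.C (a i) + Polynomial.C (b i) * Polynomial.X : R[X]).natDegree ≤ 1 :=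
    fun i ↦ by
    rw [add_comm]; exact natDegree_linear_le
  have hpow : ∀ (i : ι) (n : ℕ),
      ((Polynomial.C (a i) + Polynomial.C (b i) * Polynomial.X) ^ n : R[X]).natDegree ≤ n := fun i n ↦
    by simpa using natDegree_pow_le_of_le n (hlin i)
  have hprod : ∀ (s : Finset ι) (e : ι → ℕ),
      (∏ i ∈ s, (Polynomial.C (a i) + Polynomial.C (b i) * Polynomial.X) ^ e i : R[X]).natDegree ≤
        ∑ i ∈ s, e i ∧
      (∏ i ∈ s, (Polynomial.C (a i) + Polynomial.C (b i) * Polynomial.X) ^ e i : R[X]).coeff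
        (∑ i ∈ s, e i) =
        ∏ i ∈ s, b i ^ e i := by
    classical
    intro s e
    induction s using Finset.induction_on with
    | empty => simp
    | insert i s hi ih =>
      rw [Finset.prod_insert hi, Finset.sum_insert hi, Finset.prod_insert hi]
      refine ⟨natDegree_mul_le_of_le (hpow i _) ih.1, ?_⟩
      rw [coeff_mul_add_eq_of_natDegree_le (hpow i _) ih.1, ih.2]
      congr 1
      have := coeff_pow_of_natDegree_le (hlin i) (m := e i)
      rw [mul_one] at this
      rw [this]
      simp
  rw [MvPolynomial.aeval_def, MvPolynomial.eval₂_eq', MvPolynomial.aeval_def,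
    MvPolynomial.eval₂_eq', finsetSum_coeff]
  constructor
  · refine natDegree_sum_le_of_forall_le _ _ fun e he ↦ ?_
    rw [Polynomial.algebraMap_apply]
    exact (natDegree_C_mul_le _ _).trans (hF.sum_exponents he ▸ (hprod Finset.univ e).1)
  · refine Finset.sum_congr rfl fun e he ↦ ?_
    rw [Polynomial.algebraMap_apply, Polynomial.coeff_C_mul]
    congr 1
    rw [← hF.sum_exponents he]
    exact (hprod Finset.univ e).2

end MvPolynomial.IsHomogeneous

end Line

/-! ### Homogeneous Noether normalization -/

section Noether

open Polynomial

variable {K A : Type*} [Field K] [CommRing A] [Algebra K A] {Φ : A →ₐ[K] A[X]}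

lemma IsWeight.aeval {ι : Type*} [Fintype ι] {y : ι → A} {L d : ℕ} (hy : ∀ i, IsWeight Φ L (y i))
    {F : MvPolynomial ι K} (hF : F.IsHomogeneous d) :
    IsWeight Φ (d * L) (MvPolynomial.aeval y F) := by
  rw [MvPolynomial.aeval_def, MvPolynomial.eval₂_eq', ← mem_submodule]
  refine Submodule.sum_mem _ fun e he ↦ ?_
  rw [← Algebra.smul_def]
  refine Submodule.smul_mem _ _ ?_
  rw [← hF.sum_exponents he, Finset.sum_mul]
  exact isWeight_prod_pow hy e

/-- With one common weight L > 0, forms of different degrees d land in different weights dL, so a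
relation splits into homogeneous ones. -/
lemma aeval_homogeneousComponent_eq_zero {ι : Type*} [Fintype ι] {y : ι → A} {L : ℕ} (hL : 0 < L)
    (hy : ∀ i, IsWeight Φ L (y i)) {F : MvPolynomial ι K} (hF : MvPolynomial.aeval y F = 0)
    (d : ℕ) : MvPolynomial.aeval y (MvPolynomial.homogeneousComponent d F) = 0 := by
  by_cases hd : F.totalDegree < d
  · rw [MvPolynomial.homogeneousComponent_eq_zero _ _ hd, map_zero]
  · have h : (Φ (MvPolynomial.aeval y F)).coeff (d * L) = 0 := by rw [hF, map_zero, coeff_zero]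
    conv at h in MvPolynomial.aeval y F => rw [← MvPolynomial.sum_homogeneousComponent F]
    rw [map_sum, map_sum, finsetSum_coeff, Finset.sum_eq_single d] at h
    · rwa [(IsWeight.aeval hy (MvPolynomial.homogeneousComponent_isHomogeneous d F)).coeff_eq_self]
        at h
    · intro i _ hi
      have := IsWeight.aeval hy (MvPolynomial.homogeneousComponent_isHomogeneous i F)
      rw [IsWeight] at this
      rw [this, coeff_monomial, if_neg]
      exact fun h ↦ hi (Nat.eq_of_mul_eq_mul_right hL h)
    · intro h
      exact absurd (Finset.mem_range.2 (by omega)) h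

/-- Homogeneous Noether normalization by linear combinations. -/
lemma exists_algebraicIndependent_of_isWeight [Infinite K] [Nontrivial A] {L : ℕ} (hL : 0 < L)
    (V : Submodule K A) (hV : ∀ v ∈ V, IsWeight Φ L v) (n : ℕ) (y : Fin n → A) (hy : ∀ j, y j ∈ V)
    (hint : Algebra.IsIntegral (Algebra.adjoin K (Set.range y)) A) :
    ∃ (r : ℕ) (z : Fin r → A), (∀ j, z j ∈ V) ∧
      Algebra.IsIntegral (Algebra.adjoin K (Set.range z)) A ∧ AlgebraicIndependent K z := by
  classical
  induction n with
  | zero =>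
    exact ⟨0, y, hy, hint, algebraicIndependent_empty_type_iff.2 (algebraMap K A).injective⟩
  | succ n ih =>
    by_cases hind : AlgebraicIndependent K y
    · exact ⟨_, y, hy, hint, hind⟩
    rw [algebraicIndependent_iff] at hind
    push Not at hind
    obtain ⟨F, hF, hF0⟩ := hind
    obtain ⟨d, hd⟩ : ∃ d, MvPolynomial.homogeneousComponent d F ≠ 0 := by
      by_contra! H
      refine hF0 ?_
      rw [← MvPolynomial.sum_homogeneousComponent F]
      exact Finset.sum_eq_zero fun i _ ↦ H i
    have hG := MvPolynomial.homogeneousComponent_isHomogeneous d F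
    have hGy := aeval_homogeneousComponent_eq_zero hL (fun j ↦ hV _ (hy j)) hF d
    set G := MvPolynomial.homogeneousComponent d F
    -- A nonzero polynomial over an infinite field has a nonzero value. The point is then rescaled
    -- so that its i-th coordinate is 1.
    obtain ⟨c, hc⟩ : ∃ c, MvPolynomial.eval c G ≠ 0 := by
      by_contra! H
      exact hd (MvPolynomial.funext fun c ↦ by rw [H c, map_zero])
    have hd0 : d ≠ 0 := by
      rintro rfl
      obtain ⟨a, ha⟩ : ∃ a, G = MvPolynomial.C a :=
        ⟨_, MvPolynomial.totalDegree_eq_zero_iff_eq_C.1 (by simpa using hG.totalDegree_le)⟩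
      rw [ha] at hGy hd
      rw [MvPolynomial.aeval_C, FaithfulSMul.algebraMap_eq_zero_iff] at hGy
      exact hd (by rw [hGy, map_zero])
    obtain ⟨i, hi⟩ : ∃ i, c i ≠ 0 := by
      by_contra! H
      refine hc ?_
      have := MvPolynomial.IsHomogeneous.eval_mul hG 0 c
      rw [zero_pow hd0, zero_mul] at this
      rw [← this]
      congr 2
      funext j
      rw [H j, zero_mul]
    let b : Fin (n + 1) → K := fun j ↦ c j / c i
    have hb : MvPolynomial.eval b G ≠ 0 := by
      intro h
      have := MvPolynomial.IsHomogeneous.eval_mul hG (c i) b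
      simp only [b, mul_div_cancel₀ _ hi] at this
      rw [this, h, mul_zero] at hc
      exact hc rfl
    -- A linear change of variables keeps the new elements in V, hence of weight L. As b i = 1, the
    -- i-th one vanishes and only n remain.
    let y' : Fin (n + 1) → A := fun j ↦ y j - b j • y i
    have hy' : ∀ j, y' j ∈ V := fun j ↦ sub_mem (hy j) (V.smul_mem _ (hy i))
    let z : Fin n → A := fun j ↦ y' (i.succAbove j)
    let D := Algebra.adjoin K (Set.range z)
    have hzD : ∀ j, y' j ∈ D := by
      intro j
      obtain rfl | ⟨k, rfl⟩ := Fin.eq_self_or_eq_succAbove i j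
      · simp only [y', b, div_self hi, one_smul, sub_self]
        exact zero_mem _
      · exact Algebra.subset_adjoin ⟨k, rfl⟩
    -- The polynomial G(y' + b X) vanishes at X = y i because G(y) = 0. Its coefficient in degree d
    -- is the nonzero scalar G(b), so dividing by it gives a monic equation over D.
    have hyi : IsIntegral D (y i) := by
      obtain ⟨h1, h2⟩ := MvPolynomial.IsHomogeneous.natDegree_line_le_and_coeff hG
        (fun j ↦ (⟨y' j, hzD j⟩ : D)) (fun j ↦ algebraMap K D (b j))
      set P := MvPolynomial.aeval (fun j ↦ C (⟨y' j, hzD j⟩ : D) + C (algebraMap K D (b j)) * X) G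
      have h3 : MvPolynomial.aeval (fun j ↦ algebraMap K D (b j)) G =
          algebraMap K D (MvPolynomial.eval b G) := by
        exact MvPolynomial.aeval_algebraMap_apply D b G
      have h4 : Polynomial.aeval (y i) P = 0 := by
        rw [← hGy]
        change ((Polynomial.aeval (y i)).restrictScalars K) P = _
        rw [MvPolynomial.comp_aeval_apply]
        congr 2
        funext j
        change Polynomial.aeval (y i) (C _ + C _ * X) = _
        rw [map_add, map_mul, aeval_C, aeval_C, aeval_X]
        change y j - b j • y i + algebraMap K A (b j) * y i = y j
        rw [Algebra.smul_def, sub_add_cancel]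
      refine ⟨C (algebraMap K D (MvPolynomial.eval b G)⁻¹) * P, ?_, ?_⟩
      · refine monic_of_natDegree_le_of_coeff_eq_one d ((natDegree_C_mul_le _ _).trans h1) ?_
        rw [coeff_C_mul, h2, h3, ← map_mul, inv_mul_cancel₀ hb, map_one]
      · rw [← aeval_def, map_mul, h4, mul_zero]
    have : Algebra.IsIntegral D A := by
      refine Algebra.IsIntegral.of_adjoin (Set.range y) D ?_
      rintro _ ⟨j, rfl⟩
      have : y j = algebraMap D A ⟨y' j, hzD j⟩ + algebraMap D A (algebraMap K D (b j)) * y i := by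
        change y j = y j - b j • y i + algebraMap K A (b j) * y i
        rw [Algebra.smul_def, sub_add_cancel]
      rw [this]
      exact isIntegral_algebraMap.add (isIntegral_algebraMap.mul hyi)
    exact ih z (fun j ↦ hy' _) this

end Noether

/-! ### Semicontinuity for families of positively graded algebras -/

section Fibers

open Polynomial

/-- If an algebra is integral over the subalgebra generated by homogeneous elements `z j` of
positive weight, then homogeneous elements of positive weight are nilpotent modulo the `z j`. -/
lemma IsWeight.exists_pow_mem_span {k A : Type*} [CommRing k] [CommRing A] [Algebra k A]
    {Φ : A →ₐ[k] A[X]} {r : ℕ} {z : Fin r → A} {L : ℕ} (hz : ∀ j, IsWeight Φ L (z j)) {n : ℕ}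
    (hn : 0 < n) {a : A} (ha : IsWeight Φ n a)
    (hint : IsIntegral (Algebra.adjoin k (Set.range z)) a) :
    ∃ N, a ^ N ∈ Ideal.span (Set.range z) := by
  set I := Ideal.span (Set.range z)
  have hI : ∀ a ∈ I, (Φ a).map (Ideal.Quotient.mk I) = 0 := fun a ha ↦
    map_eq_zero_of_mem_span (by rintro _ ⟨j, rfl⟩; exact ⟨L, hz j⟩) ha
  -- Modulo the z_j the subalgebra collapses to scalars. The integral equation then has terms of
  -- pairwise distinct weights i n, so its leading term vanishes by itself.
  have hz0 : ∀ c ∈ Algebra.adjoin k (Set.range z),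
      ∃ c₀ : k, Ideal.Quotient.mk I c = algebraMap k (A ⧸ I) c₀ := by
    intro c hc
    have : Algebra.adjoin k (Set.range z) ≤ (⊥ : Subalgebra k (A ⧸ I)).comap
        (Ideal.Quotient.mkₐ k I) := by
      refine Algebra.adjoin_le ?_
      rintro _ ⟨j, rfl⟩
      change Ideal.Quotient.mk I (z j) ∈ (⊥ : Subalgebra k (A ⧸ I))
      rw [Ideal.Quotient.eq_zero_iff_mem.2 (Ideal.subset_span (Set.mem_range_self j))]
      exact zero_mem _
    obtain ⟨c₀, hc₀⟩ := Algebra.mem_bot.1 (this hc)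
    exact ⟨c₀, hc₀.symm⟩
  obtain ⟨P, hP, hP0⟩ := hint
  have h0 : ∑ i ∈ Finset.range (P.natDegree + 1),
      Ideal.Quotient.mk I (P.coeff i) * Ideal.Quotient.mk I a ^ i = 0 := by
    rw [eval₂_eq_sum_range] at hP0
    simpa using congr(Ideal.Quotient.mk I $hP0)
  refine ⟨P.natDegree, Ideal.Quotient.eq_zero_iff_mem.1 ?_⟩
  have hq := ha.quotient hI
  have h1 := congr((quotientCoaction Φ I hI $h0).coeff (P.natDegree * n))
  rw [map_sum, finsetSum_coeff, Finset.sum_eq_single P.natDegree, hP.coeff_natDegree] at h1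
  · rwa [OneMemClass.coe_one, map_one, one_mul, (hq.pow _).coeff_eq_self, map_zero, coeff_zero]
      at h1
  · intro i _ hi
    obtain ⟨c₀, hc₀⟩ := hz0 _ (P.coeff i).2
    have := (hq.pow i).smul c₀
    rw [Algebra.smul_def, ← hc₀, IsWeight] at this
    rw [this, coeff_monomial, if_neg]
    exact fun h ↦ hi (Nat.eq_of_mul_eq_mul_right hn h)
  · simp

variable {ι : Type*} [Fintype ι] {w : ι → ℕ}

/-- A homogeneous system of parameters of a graded algebra over an infinite field. -/
lemma exists_parameters {K A : Type*} [Field K] [Infinite K] [CommRing A] [Nontrivial A]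
    [Algebra K A] {Φ : A →ₐ[K] A[X]} {x : ι → A} (hw : ∀ i, 0 < w i)
    (hx : ∀ i, IsWeight Φ (w i) (x i)) (hgen : Algebra.adjoin K (Set.range x) = ⊤) :
    ∃ (L : ℕ) (e : ι → ℕ) (r : ℕ) (z : Fin r → A), 0 < L ∧ (∀ i, e i * w i = L) ∧
      (∀ j, z j ∈ Submodule.span K (Set.range fun i ↦ x i ^ e i)) ∧ ringKrullDim A = r ∧
      ∃ N, ∀ i, x i ^ N ∈ Ideal.span (Set.range z) := by
  classical
  -- A common multiple of the weights, so that suitable powers of all generators share the weight L,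
  -- as the linear normalization requires.
  let L := ∏ i, w i
  have hL : 0 < L := Finset.prod_pos fun i _ ↦ hw i
  let e : ι → ℕ := fun i ↦ L / w i
  have he : ∀ i, e i * w i = L := fun i ↦
    Nat.div_mul_cancel (Finset.dvd_prod_of_mem _ (Finset.mem_univ i))
  have he0 : ∀ i, 0 < e i := fun i ↦ Nat.pos_of_mul_pos_right (by rw [he i]; exact hL)
  let V := Submodule.span K (Set.range fun i ↦ x i ^ e i)
  have hV : V ≤ IsWeight.submodule Φ L := by
    refine Submodule.span_le.2 ?_
    rintro _ ⟨i, rfl⟩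
    have := (hx i).pow (e i)
    rwa [he i] at this
  let y : Fin (Fintype.card ι) → A := fun j ↦
    x ((Fintype.equivFin ι).symm j) ^ e ((Fintype.equivFin ι).symm j)
  have hy : ∀ j, y j ∈ V := fun j ↦ Submodule.subset_span ⟨_, rfl⟩
  have hyr : ∀ i, x i ^ e i ∈ Algebra.adjoin K (Set.range y) := fun i ↦
    Algebra.subset_adjoin ⟨Fintype.equivFin ι i, by simp [y]⟩
  have htop : Algebra.IsIntegral (Algebra.adjoin K (Set.range x)) A := by
    rw [hgen]
    exact ⟨fun a ↦ isIntegral_algebraMap (R := (⊤ : Subalgebra K A)) (x := ⟨a, trivial⟩)⟩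
  have hint : Algebra.IsIntegral (Algebra.adjoin K (Set.range y)) A := by
    refine Algebra.IsIntegral.of_adjoin (Set.range x) _ ?_
    rintro _ ⟨i, rfl⟩
    refine IsIntegral.of_pow (he0 i) ?_
    exact isIntegral_algebraMap (R := Algebra.adjoin K (Set.range y)) (x := ⟨_, hyr i⟩)
  obtain ⟨r, z, hz, hzint, hzind⟩ := exists_algebraicIndependent_of_isWeight hL V hV _ y hy hint
  refine ⟨L, e, r, z, hL, he, hz, hzind.ringKrullDim_eq_of_isIntegral_adjoin, ?_⟩
  choose N hN using fun i ↦ IsWeight.exists_pow_mem_span (fun j ↦ hV (hz j)) (hw i) (hx i)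
    (hzint.isIntegral (x i))
  exact ⟨∑ i, N i, fun i ↦ Ideal.mem_of_dvd _
    (pow_dvd_pow _ (Finset.single_le_sum (fun _ _ ↦ Nat.zero_le _) (Finset.mem_univ i))) (hN i)⟩

/-- The fibre over a maximal ideal. -/
abbrev FiberRing {B : Type*} (J : Type*) [CommRing B] [CommRing J] [Algebra B J] (p : Ideal B) :
    Type _ :=
  J ⧸ p.map (algebraMap B J)

variable {B J : Type*} [CommRing B] [CommRing J] [Algebra B J] (Φ : J →ₐ[B] J[X])

/-- The coaction on the fibre over a maximal ideal. -/
noncomputable def fiberCoaction (p : Ideal B) : FiberRing J p →ₐ[B ⧸ p] (FiberRing J p)[X] :=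
  (quotientCoaction Φ (p.map (algebraMap B J))
    fun _ ↦ map_eq_zero_of_mem_map Φ p).extendScalarsOfSurjective Ideal.Quotient.mk_surjective

lemma IsWeight.fiber (p : Ideal B) {n : ℕ} {a : J} (ha : IsWeight Φ n a) :
    IsWeight (fiberCoaction Φ p) n (Ideal.Quotient.mk _ a : FiberRing J p) :=
  ha.quotient fun _ ↦ map_eq_zero_of_mem_map Φ p

lemma adjoin_fiber {σ : Type*} (p : Ideal B) {x : σ → J}
    (hgen : Algebra.adjoin B (Set.range x) = ⊤) :
    Algebra.adjoin (B ⧸ p) (Set.range fun i ↦ (Ideal.Quotient.mk _ (x i) : FiberRing J p)) = ⊤ := by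
  rw [eq_top_iff]
  rintro a -
  obtain ⟨a, rfl⟩ := Ideal.Quotient.mk_surjective a
  have h : Algebra.adjoin B (Set.range x) ≤
      ((Algebra.adjoin (B ⧸ p) (Set.range fun i ↦
        (Ideal.Quotient.mk _ (x i) : FiberRing J p))).restrictScalars B).comap
        (Ideal.Quotient.mkₐ B (p.map (algebraMap B J))) := by
    refine Algebra.adjoin_le ?_
    rintro _ ⟨i, rfl⟩
    exact Algebra.subset_adjoin ⟨i, rfl⟩
  rw [hgen] at h
  exact h (trivial : a ∈ (⊤ : Subalgebra B J))

/-- The dimension of the fibres of a family of graded algebras is upper semicontinuous. -/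
theorem exists_forall_ringKrullDim_fiber_le {x : ι → J} (hw : ∀ i, 0 < w i)
    (hx : ∀ i, IsWeight Φ (w i) (x i)) (hgen : Algebra.adjoin B (Set.range x) = ⊤)
    (ε : J →ₐ[B] B) (p : Ideal B) [hp : p.IsMaximal] [Infinite (B ⧸ p)] :
    ∃ b ∉ p, ∀ q : Ideal B, q.IsMaximal → b ∉ q →
      ringKrullDim (FiberRing J q) ≤ ringKrullDim (FiberRing J p) := by
  classical
  let := Ideal.Quotient.field p
  -- The augmentation sends p J into p, so the fibre contains the vertex and is not empty.
  have : Nontrivial (FiberRing J p) := by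
    refine Ideal.Quotient.nontrivial_iff.2 fun h ↦ hp.ne_top ?_
    rw [Ideal.eq_top_iff_one] at h ⊢
    have h1 : p.map (algebraMap B J) ≤ p.comap ε := by
      rw [Ideal.map_le_iff_le_comap]
      intro b hb
      rw [Ideal.mem_comap, Ideal.mem_comap, AlgHom.commutes]
      exact hb
    simpa using h1 h
  obtain ⟨L, e, r, z, hL, he, hz, hdim, N, hN⟩ := exists_parameters (K := B ⧸ p) hw
    (fun i ↦ (hx i).fiber Φ p) (adjoin_fiber p hgen)
  -- The parameters are B/p-linear combinations of powers `x i ^ e i`; lifting the coefficients to B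
  -- preserves the weight.
  have hlift : ∀ j, ∃ c : J, IsWeight Φ L c ∧ Ideal.Quotient.mk _ c = z j := by
    intro j
    have h := hz j
    generalize z j = a at h
    induction h using Submodule.span_induction with
    | mem a ha =>
      obtain ⟨i, rfl⟩ := ha
      exact ⟨x i ^ e i, he i ▸ (hx i).pow _, map_pow _ _ _⟩
    | zero => exact ⟨0, .zero, map_zero _⟩
    | add a b _ _ ha hb =>
      obtain ⟨a', ha, ha'⟩ := ha
      obtain ⟨b', hb, hb'⟩ := hb
      exact ⟨a' + b', ha.add hb, by rw [map_add, ha', hb']⟩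
    | smul c a _ ha =>
      obtain ⟨a', ha, rfl⟩ := ha
      obtain ⟨c, rfl⟩ := Ideal.Quotient.mk_surjective c
      exact ⟨c • a', ha.smul c, rfl⟩
  choose c hc hcz using hlift
  set I := Ideal.span (Set.range c) with hIdef
  have hI : ∀ a ∈ I, (Φ a).map (Ideal.Quotient.mk I) = 0 := fun a ha ↦
    map_eq_zero_of_mem_span (by rintro _ ⟨j, rfl⟩; exact ⟨L, hc j⟩) ha
  have hgenI : Algebra.adjoin B (Set.range fun i ↦ Ideal.Quotient.mk I (x i)) = ⊤ := by
    have := congr(Subalgebra.map (Ideal.Quotient.mkₐ B I) $hgen)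
    rw [AlgHom.map_adjoin, Algebra.map_top,
      (AlgHom.range_eq_top _).2 (Ideal.Quotient.mkₐ_surjective B I), ← Set.range_comp] at this
    exact this
  -- Nakayama is applied to J/(c) over B: nilpotence on the fibre over p says that `x i ^ N` lies in
  -- p J + (c).
  obtain ⟨b, hb, N', hN'⟩ := exists_smul_pow_eq_zero hw (fun i ↦ (hx i).quotient hI) hgenI p N (by
    intro i
    have h1 : Ideal.span (Set.range z) = I.map (Ideal.Quotient.mk (p.map (algebraMap B J))) := by
      rw [hIdef, Ideal.map_span, ← Set.range_comp]
      congr 2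
      funext j
      exact (hcz j).symm
    have h2 := hN i
    rw [h1, ← map_pow, ← Ideal.mem_comap, Ideal.comap_map_of_surjective _
      Ideal.Quotient.mk_surjective, ← RingHom.ker_eq_comap_bot, Ideal.mk_ker] at h2
    have h3 := Ideal.mem_map_of_mem (Ideal.Quotient.mk I) h2
    rw [Ideal.map_sup, Ideal.map_quotient_self, bot_sup_eq, Ideal.map_map, map_pow] at h3
    exact h3)
  refine ⟨b, fun hbp ↦ hp.ne_top ((Ideal.eq_top_iff_one _).2 ?_), fun q hq hbq ↦ ?_⟩
  · have := sub_mem hbp hb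
    rwa [sub_sub_cancel] at this
  rw [hdim]
  let := Ideal.Quotient.field q
  let z' : Fin r → FiberRing J q := fun j ↦ Ideal.Quotient.mk _ (c j)
  -- Since b is invertible in B/q, the relation b x_i^N' ∈ (c) yields x_i^N' ∈ (z') on the fibre
  -- over q.
  have hpow : ∀ i, (Ideal.Quotient.mk _ (x i) : FiberRing J q) ^ N' ∈ Ideal.span (Set.range z') := by
    intro i
    have h1 : b • x i ^ N' ∈ I := Ideal.Quotient.eq_zero_iff_mem.1 (hN' i)
    have h2 := Ideal.mem_map_of_mem (Ideal.Quotient.mk (q.map (algebraMap B J))) h1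
    rw [hIdef, Ideal.map_span, ← Set.range_comp] at h2
    have hb0 : Ideal.Quotient.mk q b ≠ 0 := fun h ↦ hbq (Ideal.Quotient.eq_zero_iff_mem.1 h)
    have h3 : (Ideal.Quotient.mk _ (x i) : FiberRing J q) ^ N' =
        algebraMap (B ⧸ q) (FiberRing J q) (Ideal.Quotient.mk q b)⁻¹ *
          Ideal.Quotient.mk _ (b • x i ^ N') := by
      have : (Ideal.Quotient.mk _ (b • x i ^ N') : FiberRing J q) =
          Ideal.Quotient.mk q b • (Ideal.Quotient.mk _ (x i)) ^ N' := by rw [← map_pow]; rfl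
      rw [this, ← Algebra.smul_def, inv_smul_smul₀ hb0]
    rw [h3]
    exact Ideal.mul_mem_left _ _ h2
  have := isIntegral_of_pow_mem hw (fun i ↦ (hx i).fiber Φ q) (adjoin_fiber q hgen) z' hL
    (fun j ↦ (hc j).fiber Φ q) N' hpow
  exact ringKrullDim_le_of_isIntegral_adjoin (K := B ⧸ q) z'

end Fibers

/-! ### The grading on jet algebras and on based jets -/

namespace JetAlgebra

section Generators

variable {k R : Type u} [CommRing k] [CommRing R] [Algebra k R] {m j : ℕ}

lemma D_add (hj : j < m + 1) (r s : R) :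
    (D j (r + s) : JetAlgebra k R m) = D j r + D j s :=
  mk_eq_of_rel k R m (.add r s j (by omega)) |>.trans (map_add _ _ _)

lemma D_mul (hj : j < m + 1) (r s : R) :
    (D j (r * s) : JetAlgebra k R m) =
      ∑ p ∈ Finset.HasAntidiagonal.antidiagonal j, D p.1 r * D p.2 s := by
  refine (mk_eq_of_rel k R m (.mul r s j (by omega))).trans ?_
  rw [map_sum]
  exact Finset.sum_congr rfl fun p _ ↦ map_mul _ _ _

lemma D_algebraMap (hj : j < m + 1) (c : k) :
    (D j (algebraMap k R c) : JetAlgebra k R m) = if j = 0 then algebraMap k _ c else 0 := by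
  refine (mk_eq_of_rel k R m (.scalar c j (by omega))).trans ?_
  split_ifs
  · rw [← MvPolynomial.algebraMap_eq, AlgHom.commutes]
  · exact map_zero _

/-- Stated for ring homomorphisms and subrings because the comparison maps below change the ring of
scalars. -/
lemma map_mem_of_forall_D {A : Type*} [CommRing A] (f : JetAlgebra k R m →+* A) (T : Subring A)
    (hk : ∀ c, f (algebraMap k _ c) ∈ T) (hD : ∀ j < m + 1, ∀ r : R, f (D j r) ∈ T)
    (a : JetAlgebra k R m) : f a ∈ T := by
  obtain ⟨p, rfl⟩ := mk_surjective k R m a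
  induction p using MvPolynomial.induction_on with
  | C c =>
    rw [← MvPolynomial.algebraMap_eq, AlgHom.commutes]
    exact hk c
  | add p q hp hq => rw [map_add, map_add]; exact add_mem hp hq
  | mul_X p i hp =>
    rw [map_mul, map_mul]
    refine mul_mem hp ?_
    have := hD i.2 i.2.2 i.1
    rwa [D, gen, dif_pos i.2.2] at this

end Generators

open Polynomial

variable {B R : Type u} [CommRing B] [CommRing R] [Algebra B R] {m : ℕ}

variable (B R m) in
/-- The coaction `r⁽ʲ⁾ ↦ r⁽ʲ⁾ T^j` given by rescaling the parameter of jets. -/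
noncomputable def coaction : JetAlgebra B R m →ₐ[B] (JetAlgebra B R m)[X] :=
  Ideal.Quotient.liftₐ _ (MvPolynomial.aeval fun x ↦ monomial (x.2 : ℕ) (D x.2 x.1)) (by
    have key : ∀ (r : R) (j : ℕ), j < m + 1 →
        MvPolynomial.aeval (fun x : R × Fin (m + 1) ↦
          monomial (x.2 : ℕ) (D x.2 x.1 : JetAlgebra B R m)) (gen B R m r j) =
            monomial j (D j r) := by
      intro r j hj
      simp [gen, hj]
    intro a ha
    refine (Ideal.span_le (I := RingHom.ker (MvPolynomial.aeval (R := B)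
      fun x : R × Fin (m + 1) ↦ monomial (x.2 : ℕ) (D x.2 x.1 : JetAlgebra B R m)))).2 ?_ ha
    rintro _ ⟨p, q, h, rfl⟩
    rw [SetLike.mem_coe, RingHom.mem_ker, map_sub, sub_eq_zero]
    cases h with
    | add r s j hj =>
      rw [map_add, key _ _ (by omega), key _ _ (by omega), key _ _ (by omega),
        D_add (by omega), map_add]
    | mul r s j hj =>
      rw [map_sum, key _ _ (by omega), D_mul (by omega), map_sum]
      refine Finset.sum_congr rfl fun p hp ↦ ?_
      have := Finset.HasAntidiagonal.mem_antidiagonal.1 hp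
      refine Eq.trans ?_ (map_mul _ _ _).symm
      rw [key _ _ (by omega), key _ _ (by omega), monomial_mul_monomial, this]
    | scalar c j hj =>
      rw [key _ _ (by omega), D_algebraMap (by omega)]
      split_ifs with h
      · rw [h, ← MvPolynomial.algebraMap_eq, AlgHom.commutes, monomial_zero_left]
        rfl
      · simp)

lemma isWeight_D {j : ℕ} (hj : j < m + 1) (r : R) : IsWeight (coaction B R m) j (D j r) := by
  change MvPolynomial.aeval _ (gen B R m r j) = _
  simp [gen, hj]

section Based

variable (m) (e : R →ₐ[B] B)

/-- The ideal of the jets whose base point lies on the section defined by `e`. -/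
noncomputable def sectionIdeal : Ideal (JetAlgebra B R m) := (RingHom.ker e).map (base B R m)

/-- The algebra of the jets whose base point lies on the section defined by `e`. -/
abbrev Based : Type u := JetAlgebra B R m ⧸ sectionIdeal m e

lemma map_coaction_eq_zero (a : JetAlgebra B R m) (ha : a ∈ sectionIdeal m e) :
    (coaction B R m a).map (Ideal.Quotient.mk (sectionIdeal m e)) = 0 := by
  refine map_eq_zero_of_mem_span ?_ ha
  rintro _ ⟨r, _, rfl⟩
  exact ⟨0, isWeight_D (by omega) r⟩

/-- The coaction on the algebra of based jets. -/
noncomputable def basedCoaction : Based m e →ₐ[B] (Based m e)[X] :=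
  quotientCoaction (coaction B R m) (sectionIdeal m e) (map_coaction_eq_zero m e)

/-- The constant jet along the section. -/
noncomputable def basedAugmentation : Based m e →ₐ[B] B :=
  Ideal.Quotient.liftₐ _ (ofJet ((Algebra.ofId B (TruncPoly B m)).comp e)) fun a ha ↦ by
    have : sectionIdeal m e ≤ RingHom.ker (ofJet ((Algebra.ofId B (TruncPoly B m)).comp e)) := by
      rw [sectionIdeal, Ideal.map_le_iff_le_comap]
      intro r hr
      rw [RingHom.mem_ker] at hr
      change ofJet _ (D 0 r) = 0
      rw [ofJet_D _ (by omega), AlgHom.comp_apply, hr, map_zero,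
        ← map_zero (algebraMap B (TruncPoly B m)), TruncPoly.coeff_algebraMap (by omega)]
      simp
    exact this ha

/-- The difference of r and the scalar e(r) lies in the kernel of e. Thus the generators of weight
zero become scalars on based jets. -/
lemma mk_base_eq_algebraMap (r : R) :
    (Ideal.Quotient.mk (sectionIdeal m e) (D 0 r)) = algebraMap B (Based m e) (e r) := by
  have h1 : algebraMap B (Based m e) (e r) =
      Ideal.Quotient.mk (sectionIdeal m e) (base B R m (algebraMap B R (e r))) := by
    rw [AlgHom.commutes]
    rfl
  rw [h1, Ideal.Quotient.eq]
  change base B R m r - _ ∈ _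
  rw [← map_sub]
  refine Ideal.mem_map_of_mem _ ?_
  rw [RingHom.mem_ker, map_sub, AlgHom.commutes, Algebra.algebraMap_self_apply, sub_self]

/-- The Leibniz formula reduces r⁽ʲ⁾ to algebra generators of R, and those with j = 0 are scalars.
The shift `x.2 + 1` leaves only positive weights. -/
lemma adjoin_based_eq_top {G : Set R} (hG : Algebra.adjoin B G = ⊤) :
    Algebra.adjoin B (Set.range fun x : G × Fin m ↦
      Ideal.Quotient.mk (sectionIdeal m e) (D (x.2 + 1 : ℕ) (x.1 : R))) = ⊤ := by
  set T := Algebra.adjoin B (Set.range fun x : G × Fin m ↦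
      Ideal.Quotient.mk (sectionIdeal m e) (D (x.2 + 1 : ℕ) (x.1 : R)))
  have key : ∀ r : R, ∀ j < m + 1, Ideal.Quotient.mk (sectionIdeal m e) (D j r) ∈ T := by
    intro r
    have hr : r ∈ Algebra.adjoin B G := by rw [hG]; trivial
    induction hr using Algebra.adjoin_induction with
    | mem g hg =>
      intro j hj
      obtain _ | j := j
      · rw [mk_base_eq_algebraMap]
        exact T.algebraMap_mem _
      · exact Algebra.subset_adjoin ⟨(⟨g, hg⟩, ⟨j, by omega⟩), rfl⟩
    | algebraMap c =>
      intro j hj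
      rw [D_algebraMap hj]
      split_ifs
      · exact T.algebraMap_mem c
      · rw [map_zero]; exact zero_mem _
    | add r s _ _ hr hs =>
      intro j hj
      rw [D_add hj, map_add]
      exact add_mem (hr j hj) (hs j hj)
    | mul r s _ _ hr hs =>
      intro j hj
      rw [D_mul hj, map_sum]
      refine sum_mem fun p hp ↦ ?_
      have := Finset.HasAntidiagonal.mem_antidiagonal.1 hp
      rw [map_mul]
      exact mul_mem (hr _ (by omega)) (hs _ (by omega))
  rw [eq_top_iff]
  rintro a -
  obtain ⟨a, rfl⟩ := Ideal.Quotient.mk_surjective a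
  exact map_mem_of_forall_D (Ideal.Quotient.mk (sectionIdeal m e)) T.toSubring
    (fun c ↦ T.algebraMap_mem c) (fun j hj r ↦ key r j hj) a

/-- The dimension of the fibres of the scheme of based jets is upper semicontinuous. -/
theorem exists_forall_ringKrullDim_based_le [Algebra.FiniteType B R] (p : Ideal B) [p.IsMaximal]
    [Infinite (B ⧸ p)] :
    ∃ b ∉ p, ∀ q : Ideal B, q.IsMaximal → b ∉ q →
      ringKrullDim (FiberRing (Based m e) q) ≤ ringKrullDim (FiberRing (Based m e) p) := by
  obtain ⟨G, hG⟩ := Algebra.FiniteType.out (R := B) (A := R)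
  exact exists_forall_ringKrullDim_fiber_le (basedCoaction m e)
    (ι := ↥(G : Set R) × Fin m) (w := fun x ↦ x.2 + 1) (fun _ ↦ Nat.succ_pos _)
    (fun x ↦ (isWeight_D (by omega) (x.1 : R)).quotient _) (adjoin_based_eq_top m e hG)
    (basedAugmentation m e) p

end Based

/-! ### Based jets commute with passing to a closed fibre -/

section BaseChange

variable (m) {k R' A : Type u} [CommRing k] [CommRing R'] [Algebra k R'] [CommRing A]

/-- Composing a jet of R' with ρ gives a jet of R, linear over B once B acts on A through σ. -/
lemma exists_ringHom_of_section [Algebra k A] (φ : JetAlgebra k R' m →ₐ[k] A) (σ : B →+* k)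
    (ρ : R →+* R') (h : ∀ b, ρ (algebraMap B R b) = algebraMap k R' (σ b)) :
    ∃ ψ : JetAlgebra B R m →+* A, (∀ b, ψ (algebraMap B _ b) = algebraMap k A (σ b)) ∧
      ∀ j < m + 1, ∀ r, ψ (D j r) = φ (D j (ρ r)) := by
  let : Algebra B A := ((algebraMap k A).comp σ).toAlgebra
  obtain ⟨g₀, hg₀⟩ : ∃ g₀ : R →+* TruncPoly A m, ∀ r, g₀ r = toJet φ (ρ r) :=
    ⟨(toJet φ).toRingHom.comp ρ, fun _ ↦ rfl⟩
  let g : R →ₐ[B] TruncPoly A m :=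
    { g₀ with
      commutes' := fun b ↦ by
        change g₀ (algebraMap B R b) = _
        rw [hg₀, h b, AlgHom.commutes]
        rfl }
  refine ⟨(ofJet g).toRingHom, fun b ↦ (ofJet g).commutes b, fun j hj r ↦ ?_⟩
  change ofJet g (D j r) = _
  rw [ofJet_D _ hj, ← coeff_toJet _ hj]
  exact congrArg _ (hg₀ r)

variable [Algebra k B]

/-- A jet of R with values in an algebra killed by p kills p R = ker ρ, hence factors through R'. -/
lemma exists_ringHom_of_surjective [Algebra B A] (φ : JetAlgebra B R m →ₐ[B] A) {ρ : R →+* R'}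
    (hρ : Function.Surjective ρ) {p : Ideal B} (hker : RingHom.ker ρ = p.map (algebraMap B R))
    (hk : ∀ c : k, ρ (algebraMap B R (algebraMap k B c)) = algebraMap k R' c)
    (hA : ∀ b ∈ p, algebraMap B A b = 0) :
    ∃ ψ : JetAlgebra k R' m →+* A,
      (∀ c, ψ (algebraMap k _ c) = algebraMap B A (algebraMap k B c)) ∧
      ∀ j < m + 1, ∀ r, ψ (D j (ρ r)) = φ (D j r) := by
  let : Algebra k A := ((algebraMap B A).comp (algebraMap k B)).toAlgebra
  have hg : RingHom.ker ρ ≤ RingHom.ker (toJet φ).toRingHom := by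
    rw [hker, Ideal.map_le_iff_le_comap]
    intro b hb
    change toJet φ (algebraMap B R b) = 0
    rw [AlgHom.commutes]
    change Ideal.Quotient.mk _ (C (algebraMap B A b)) = 0
    rw [hA b hb, map_zero, map_zero]
  let g₀ : R' →+* TruncPoly A m := ρ.liftOfSurjective hρ ⟨(toJet φ).toRingHom, hg⟩
  have hg₀ : ∀ r, g₀ (ρ r) = toJet φ r := fun r ↦
    RingHom.liftOfRightInverse_comp_apply _ _ _ _ r
  let g : R' →ₐ[k] TruncPoly A m :=
    { g₀ with
      commutes' := fun c ↦ by
        change g₀ (algebraMap k R' c) = _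
        rw [← hk, hg₀, AlgHom.commutes]
        rfl }
  refine ⟨(ofJet g).toRingHom, fun c ↦ (ofJet g).commutes c, fun j hj r ↦ ?_⟩
  change ofJet g (D j (ρ r)) = _
  rw [ofJet_D _ hj, ← coeff_toJet _ hj]
  exact congrArg _ (hg₀ r)

variable {p : Ideal B} {ρ : R →+* R'}

/-- The two rings represent the same functor, but equality of dimensions only needs a surjection
each way. Here the jet functor is applied to ρ, with B acting through the residue map σ : B → k. -/
lemma ringKrullDim_quotient_map_base_le (e : R →ₐ[B] B)
    (hp : Function.Bijective (algebraMap k (B ⧸ p)))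
    (hρ : Function.Surjective ρ) (hker : RingHom.ker ρ = p.map (algebraMap B R))
    (hk : ∀ c : k, ρ (algebraMap B R (algebraMap k B c)) = algebraMap k R' c) :
    ringKrullDim (JetAlgebra k R' m ⧸ ((RingHom.ker e).map ρ).map (base k R' m)) ≤
      ringKrullDim (FiberRing (Based m e) p) := by
  set P := ((RingHom.ker e).map ρ).map (base k R' m)
  obtain ⟨σ, hσk⟩ : ∃ σ : B →+* k, ∀ b, algebraMap k (B ⧸ p) (σ b) = Ideal.Quotient.mk p b :=
    ⟨(RingEquiv.ofBijective (algebraMap k (B ⧸ p)) hp).symm.toRingHom.comp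
      (Ideal.Quotient.mk p), fun b ↦
        (RingEquiv.ofBijective (algebraMap k (B ⧸ p)) hp).apply_symm_apply _⟩
  have hσ0 : ∀ b ∈ p, σ b = 0 := fun b hb ↦ hp.1 (by
    rw [hσk, Ideal.Quotient.eq_zero_iff_mem.2 hb, map_zero])
  have hσc : ∀ c, σ (algebraMap k B c) = c := fun c ↦ hp.1 (hσk _)
  have hρσ : ∀ b : B, ρ (algebraMap B R b) = algebraMap k R' (σ b) := fun b ↦ by
    have hb : b - algebraMap k B (σ b) ∈ p := Ideal.Quotient.eq.1 (hσk b).symm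
    have := Ideal.mem_map_of_mem (algebraMap B R) hb
    rwa [← hker, RingHom.mem_ker, map_sub, map_sub, sub_eq_zero, hk] at this
  obtain ⟨ψ, hψ, hD⟩ := exists_ringHom_of_section m (Ideal.Quotient.mkₐ k P) σ ρ hρσ
  have h1 : sectionIdeal m e ≤ RingHom.ker ψ := by
    rw [sectionIdeal, Ideal.map_le_iff_le_comap]
    intro r hr
    change ψ (D 0 r) = 0
    rw [hD 0 (by omega)]
    exact Ideal.Quotient.eq_zero_iff_mem.2
      (Ideal.mem_map_of_mem (base k R' m) (Ideal.mem_map_of_mem ρ hr))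
  let f₁ : Based m e →+* JetAlgebra k R' m ⧸ P := Ideal.Quotient.lift _ ψ h1
  have h2 : p.map (algebraMap B (Based m e)) ≤ RingHom.ker f₁ := by
    rw [Ideal.map_le_iff_le_comap]
    intro b hb
    change ψ (algebraMap B _ b) = 0
    rw [hψ, hσ0 b hb, map_zero]
  let f : FiberRing (Based m e) p →+* JetAlgebra k R' m ⧸ P := Ideal.Quotient.lift _ f₁ h2
  refine ringKrullDim_le_of_surjective f fun a ↦ ?_
  obtain ⟨a, rfl⟩ := Ideal.Quotient.mk_surjective a
  refine map_mem_of_forall_D (Ideal.Quotient.mk P) f.range (fun c ↦ ?_) (fun j hj r ↦ ?_) a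
  · refine ⟨Ideal.Quotient.mk _ (Ideal.Quotient.mk _ (algebraMap B _ (algebraMap k B c))), ?_⟩
    change ψ (algebraMap B _ _) = _
    rw [hψ, hσc]
    rfl
  · obtain ⟨r, rfl⟩ := hρ r
    exact ⟨Ideal.Quotient.mk _ (Ideal.Quotient.mk _ (D j r)), hD j hj r⟩

/-- The reverse surjection: the universal based jet on the fibre over p descends along ρ from R to
R'. -/
lemma le_ringKrullDim_quotient_map_base (e : R →ₐ[B] B)
    (hp : Function.Surjective (algebraMap k (B ⧸ p)))
    (hρ : Function.Surjective ρ) (hker : RingHom.ker ρ = p.map (algebraMap B R))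
    (hk : ∀ c : k, ρ (algebraMap B R (algebraMap k B c)) = algebraMap k R' c) :
    ringKrullDim (FiberRing (Based m e) p) ≤
      ringKrullDim (JetAlgebra k R' m ⧸ ((RingHom.ker e).map ρ).map (base k R' m)) := by
  set P := ((RingHom.ker e).map ρ).map (base k R' m) with hP
  let q : JetAlgebra B R m →ₐ[B] FiberRing (Based m e) p :=
    (Ideal.Quotient.mkₐ B (p.map (algebraMap B (Based m e)))).comp
      (Ideal.Quotient.mkₐ B (sectionIdeal m e))
  have hq : Function.Surjective q :=
    (Ideal.Quotient.mkₐ_surjective B (p.map (algebraMap B (Based m e)))).comp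
      (Ideal.Quotient.mkₐ_surjective B (sectionIdeal m e))
  have hQ0 : ∀ b ∈ p, algebraMap B (FiberRing (Based m e) p) b = 0 := fun b hb ↦
    Ideal.Quotient.eq_zero_iff_mem.2 (Ideal.mem_map_of_mem (algebraMap B (Based m e)) hb)
  obtain ⟨ψ, hψ, hD⟩ := exists_ringHom_of_surjective m q hρ hker hk hQ0
  have h1 : P ≤ RingHom.ker ψ := by
    rw [hP, Ideal.map_le_iff_le_comap, Ideal.map_le_iff_le_comap]
    intro r hr
    change ψ (D 0 (ρ r)) = 0
    rw [hD 0 (by omega)]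
    have h0 : Ideal.Quotient.mk (sectionIdeal m e) (base B R m r) = 0 :=
      Ideal.Quotient.eq_zero_iff_mem.2 (Ideal.mem_map_of_mem (base B R m) hr)
    change Ideal.Quotient.mk _ (Ideal.Quotient.mk (sectionIdeal m e) (base B R m r)) = 0
    rw [h0, map_zero]
  let f : JetAlgebra k R' m ⧸ P →+* FiberRing (Based m e) p := Ideal.Quotient.lift _ ψ h1
  refine ringKrullDim_le_of_surjective f fun a ↦ ?_
  obtain ⟨a, rfl⟩ := hq a
  refine map_mem_of_forall_D q.toRingHom f.range (fun b ↦ ?_) (fun j hj r ↦ ?_) a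
  · obtain ⟨c, hc⟩ := hp (Ideal.Quotient.mk p b)
    refine ⟨Ideal.Quotient.mk P (algebraMap k _ c), ?_⟩
    change ψ (algebraMap k _ c) = q (algebraMap B _ b)
    rw [AlgHom.commutes, hψ, eq_comm, ← sub_eq_zero, ← map_sub]
    exact hQ0 _ (Ideal.Quotient.eq.1 hc.symm)
  · exact ⟨Ideal.Quotient.mk _ (D j (ρ r)), hD j hj r⟩

/-- The fibre of the scheme of based jets over a rational point is the scheme of based jets of the
fibre. -/
theorem ringKrullDim_quotient_map_base (e : R →ₐ[B] B)
    (hp : Function.Bijective (algebraMap k (B ⧸ p)))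
    (hρ : Function.Surjective ρ) (hker : RingHom.ker ρ = p.map (algebraMap B R))
    (hk : ∀ c : k, ρ (algebraMap B R (algebraMap k B c)) = algebraMap k R' c) :
    ringKrullDim (JetAlgebra k R' m ⧸ ((RingHom.ker e).map ρ).map (base k R' m)) =
      ringKrullDim (FiberRing (Based m e) p) :=
  (ringKrullDim_quotient_map_base_le m e hp hρ hker hk).antisymm
    (le_ringKrullDim_quotient_map_base m e hp.2 hρ hker hk)

end BaseChange

end JetAlgebra

/-! ### Fibres of the jet projection in affine charts -/

/-- The hypotheses identify F with the image of the closed subset V(I) of Spec A, so F is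
homeomorphic to Spec (A/I). -/
lemma topologicalKrullDim_eq_ringKrullDim_quotient {A X : Type*} [CommRing A] [TopologicalSpace X]
    (I : Ideal A) {j : PrimeSpectrum A → X} (hj : Topology.IsEmbedding j) {F : Set X}
    (hF : F ⊆ Set.range j) (hI : ∀ y, j y ∈ F ↔ I ≤ y.asIdeal) :
    topologicalKrullDim F = ringKrullDim (A ⧸ I) := by
  let g := j ∘ PrimeSpectrum.comap (Ideal.Quotient.mk I)
  have hg : Topology.IsEmbedding g := hj.comp
    (PrimeSpectrum.isClosedEmbedding_comap_of_surjective _ _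
      Ideal.Quotient.mk_surjective).isEmbedding
  have hrange : Set.range g = F := by
    rw [Set.range_comp, range_comap_of_surjective _ _ Ideal.Quotient.mk_surjective, Ideal.mk_ker]
    ext y
    constructor
    · rintro ⟨y, hy, rfl⟩
      exact (hI y).2 hy
    · intro hy
      obtain ⟨y, rfl⟩ := hF hy
      exact ⟨y, (hI y).1 hy, rfl⟩
  rw [← PrimeSpectrum.topologicalKrullDim_eq_ringKrullDim]
  exact (IsHomeomorph.topologicalKrullDim_eq _
    (hg.toHomeomorph.trans (Homeomorph.setCongr hrange)).isHomeomorph).symm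

namespace AlgebraicGeometry.Scheme

open Limits

section JetFiber

variable {k : Type u} [CommRing k] {W : Scheme.{u}} (p : W ⟶ Spec (.of k)) (m : ℕ)

/-- The inclusion of the jet scheme of an affine open subset. -/
noncomputable def jetι (U : W.AffineZariskiSite) : Spec (jetSections p m U.1) ⟶ jetScheme p m :=
  (AffineZariskiSite.relativeGluingData (coequifibered_toJetPresheaf p m)).cover.f U

instance (U : W.AffineZariskiSite) : IsOpenImmersion (jetι p m U) :=
  (AffineZariskiSite.relativeGluingData (coequifibered_toJetPresheaf p m)).cover.map_prop U

lemma range_jetι (U : W.AffineZariskiSite) :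
    Set.range (jetι p m U) = jetProj p m ⁻¹' (U.1 : Set W) := by
  have := (AffineZariskiSite.relativeGluingData
    (coequifibered_toJetPresheaf p m)).preimage_toBase_eq_range_ι U
  refine this.symm.trans ?_
  congr 1
  exact Scheme.Opens.range_ι U.1

lemma jetι_jetProj (U : W.AffineZariskiSite) :
    jetι p m U ≫ jetProj p m =
      Spec.map ((toJetPresheaf p m).app (.op U)) ≫ U.2.fromSpec := by
  refine ((AffineZariskiSite.relativeGluingData
    (coequifibered_toJetPresheaf p m)).ι_toBase U).trans ?_
  rfl

/-- The dimension of the fibre of the jet scheme over a closed point of an affine open subset. -/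
lemma topologicalKrullDim_fiber_jetProj {U : W.Opens} (hU : IsAffineOpen U) {x : W} (hx : x ∈ U)
    (hmax : (hU.primeIdealOf ⟨x, hx⟩).asIdeal.IsMaximal) :
    letI := sectionsAlgebra p U
    topologicalKrullDim ((jetProj p m).fiber x) =
      ringKrullDim (JetAlgebra k Γ(W, U) m ⧸
        (hU.primeIdealOf ⟨x, hx⟩).asIdeal.map (JetAlgebra.base k Γ(W, U) m)) := by
  let := sectionsAlgebra p U
  let A := JetAlgebra k Γ(W, U) m
  let φ : Γ(W, U) →+* A := (JetAlgebra.base k Γ(W, U) m).toRingHom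
  let P := (hU.primeIdealOf ⟨x, hx⟩).asIdeal
  let I : Ideal A := P.map φ
  let U' : W.AffineZariskiSite := ⟨U, hU⟩
  have hι : ∀ y : PrimeSpectrum A,
      jetProj p m (jetι p m U' y) = hU.fromSpec (PrimeSpectrum.comap φ y) :=
    fun y ↦ congr($(jetι_jetProj p m U') y)
  -- A point lies over x when its contraction equals P; maximality of P weakens this to containing
  -- P, which is a closed condition.
  have hfib : ∀ y : PrimeSpectrum A, jetProj p m (jetι p m U' y) = x ↔ I ≤ y.asIdeal := fun y ↦ by
    have hx' := hU.fromSpec_primeIdealOf ⟨x, hx⟩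
    constructor
    · intro h
      have h' := hU.fromSpec.isOpenEmbedding.injective ((hι y).symm.trans (h.trans hx'.symm))
      exact Ideal.map_le_iff_le_comap.2 (congr_arg PrimeSpectrum.asIdeal h').ge
    · intro h
      have h' : PrimeSpectrum.comap φ y = hU.primeIdealOf ⟨x, hx⟩ := PrimeSpectrum.ext
        (hmax.eq_of_le (PrimeSpectrum.comap φ y).2.ne_top (Ideal.map_le_iff_le_comap.1 h)).symm
      exact (hι y).trans ((congr_arg hU.fromSpec h').trans hx')
  have h := topologicalKrullDim_eq_ringKrullDim_quotient I
    (jetι p m U').isOpenEmbedding.isEmbedding (F := jetProj p m ⁻¹' {x}) (by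
      intro y hy
      refine (range_jetι p m U').ge ?_
      change jetProj p m y ∈ U
      rw [show jetProj p m y = x from hy]
      exact hx) hfib
  rw [← IsHomeomorph.topologicalKrullDim_eq _ ((jetProj p m).fiberHomeo x).symm.isHomeomorph]
  exact h

end JetFiber

/-! ### Closed fibres of π in affine charts -/

/-- Base change along a quotient map is again a quotient: R → R/(ker f)R factors through the pushout
R', so it kills ker g. -/
lemma ker_eq_map_ker_of_isPushout {B R K R' : CommRingCat.{u}} {a : B ⟶ R} {f : B ⟶ K}
    {g : R ⟶ R'} {h : K ⟶ R'} (H : IsPushout a f g h) (hf : Function.Surjective f) :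
    RingHom.ker g.hom = (RingHom.ker f.hom).map a.hom := by
  apply le_antisymm
  · let I := (RingHom.ker f.hom).map a.hom
    let q : B →+* R ⧸ I := (Ideal.Quotient.mk I).comp a.hom
    have hq : RingHom.ker f.hom ≤ RingHom.ker q := fun b hb ↦
      Ideal.Quotient.eq_zero_iff_mem.2 (Ideal.mem_map_of_mem _ hb)
    let t : K →+* R ⧸ I := f.hom.liftOfSurjective hf ⟨q, hq⟩
    have ht : ∀ b, t (f b) = Ideal.Quotient.mk I (a b) := fun b ↦
      RingHom.liftOfRightInverse_comp_apply _ _ _ ⟨q, hq⟩ b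
    let d : R' ⟶ .of (R ⧸ I) := H.desc (CommRingCat.ofHom (Ideal.Quotient.mk I))
      (CommRingCat.ofHom t) (by ext b; exact (ht b).symm)
    intro r hr
    have hd : d (g r) = Ideal.Quotient.mk I r :=
      congr($(H.inl_desc (CommRingCat.ofHom (Ideal.Quotient.mk I))
        (CommRingCat.ofHom t) (by ext b; exact (ht b).symm)) r)
    rw [show g r = 0 from hr, map_zero] at hd
    exact Ideal.Quotient.eq_zero_iff_mem.1 hd.symm
  · rw [Ideal.map_le_iff_le_comap]
    intro b hb
    have := congr($(H.w) b)
    change g (a b) = 0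
    refine this.trans ?_
    change h (f b) = 0
    rw [show f b = 0 from hb, map_zero]

section Fiber

variable {S W : Scheme.{u}} (π : W ⟶ S) {s : S} (hs : IsClosed {s})

include hs in
lemma isClosedImmersion_fiberι : IsClosedImmersion (π.fiberι s) := by
  have := isClosed_singleton_iff_isClosedImmersion.1 hs
  exact MorphismProperty.of_isPullback (P := @IsClosedImmersion)
    (IsPullback.of_hasPullback π (S.fromSpecResidueField s)).flip this

variable {V : S.Opens} (hV : IsAffineOpen V) (hsV : s ∈ V) {U : W.Opens} (hU : IsAffineOpen U)
  (hUV : U ≤ π ⁻¹ᵁ V)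

include hs hU in
lemma isAffineOpen_fiberι_preimage : IsAffineOpen (π.fiberι s ⁻¹ᵁ U) := by
  have := isClosedImmersion_fiberι π hs
  exact hU.preimage _

include hs hU in
lemma fiberι_app_surjective : Function.Surjective ((π.fiberι s).app U) := by
  have := isClosedImmersion_fiberι π hs
  exact (π.fiberι s).app_surjective U hU

lemma isField_sections_of_eq_top {K : Type u} [Field K] (O : (Spec (.of K)).Opens) (hO : O = ⊤) :
    IsField Γ(Spec (.of K), O) := by
  subst hO
  exact MulEquiv.isField (Field.toIsField K)
    (Scheme.ΓSpecIso (.of K)).commRingCatIsoToRingEquiv.toMulEquiv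

include hs in
-- The sections over the preimage of V form a field, and contracting its zero ideal gives the prime
-- of the image point s.
lemma ker_fromSpecResidueField_app :
    RingHom.ker ((S.fromSpecResidueField s).app V).hom =
      (hV.primeIdealOf ⟨s, hsV⟩).asIdeal := by
  have := isClosed_singleton_iff_isClosedImmersion.1 hs
  let f := S.fromSpecResidueField s
  have hT : IsAffineOpen (f ⁻¹ᵁ V) := hV.preimage f
  have htop : f ⁻¹ᵁ V = ⊤ := by
    ext y
    simpa [f] using hsV
  have hF : IsField Γ(Spec (S.residueField s), f ⁻¹ᵁ V) := isField_sections_of_eq_top _ htop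
  let y : Spec (S.residueField s) := IsLocalRing.closedPoint _
  have hfy : f y = s := S.fromSpecResidueField_apply s y
  have hy : y ∈ f ⁻¹ᵁ V := by rw [htop]; trivial
  have h := congr_arg PrimeSpectrum.asIdeal
    (IsAffineOpen.comap_primeIdealOf_appLE (f := f) V hV (f ⁻¹ᵁ V) hT le_rfl hy)
  have h1 : (hT.primeIdealOf ⟨y, hy⟩).asIdeal = ⊥ := by
    let := hF.toField
    exact (Ideal.eq_bot_or_top _).resolve_right (hT.primeIdealOf ⟨y, hy⟩).2.ne_top
  have h2 : hV.primeIdealOf ⟨f y, hy⟩ = hV.primeIdealOf ⟨s, hsV⟩ := by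
    congr 1
    exact Subtype.ext hfy
  rw [PrimeSpectrum.comap_asIdeal, h1, Scheme.Hom.appLE_eq_app] at h
  exact h.trans (congr_arg PrimeSpectrum.asIdeal h2)

include hs hV hsV hU in
-- The part of the fibre inside U is U ×_V Spec κ(s), so on sections it is a pushout along the
-- quotient map with kernel the prime of s.
lemma ker_fiberι_app :
    RingHom.ker ((π.fiberι s).app U).hom =
      (hV.primeIdealOf ⟨s, hsV⟩).asIdeal.map (π.appLE V U hUV).hom := by
  have := isClosed_singleton_iff_isClosedImmersion.1 hs
  have H : IsPullback (π.fiberι s) (π.fiberToSpecResidueField s) π (S.fromSpecResidueField s) :=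
    IsPullback.of_hasPullback _ _
  have hUY : π.fiberι s ⁻¹ᵁ U = π.fiberι s ⁻¹ᵁ U ⊓
      π.fiberToSpecResidueField s ⁻¹ᵁ (S.fromSpecResidueField s ⁻¹ᵁ V) := by
    refine (inf_eq_left.2 ?_).symm
    rw [← Scheme.Hom.comp_preimage, ← π.fiber_fac, Scheme.Hom.comp_preimage]
    exact fun x hx ↦ hUV hx
  have h1 := (isIso_pushoutSection_iff H (US := V) (UT := S.fromSpecResidueField s ⁻¹ᵁ V) le_rfl
    hUV hUY).1 (isIso_pushoutSection_of_isAffineOpen H le_rfl hUV hUY hV (hV.preimage _) hU)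
  have h2 := ker_eq_map_ker_of_isPushout h1 (by
    rw [Scheme.Hom.appLE_eq_app]
    exact Scheme.Hom.app_surjective _ V hV)
  rw [Scheme.Hom.appLE_eq_app, Scheme.Hom.appLE_eq_app,
    ker_fromSpecResidueField_app hs hV hsV] at h2
  exact h2

end Fiber

end AlgebraicGeometry.Scheme

/-! ### From the jet fibre at τ(s) to the fibre of based jets -/

namespace AlgebraicGeometry.Scheme

section SectionPoint

variable {S W : Scheme.{u}} (π : W ⟶ S) (τ : S ⟶ W) (hτ : τ ≫ π = 𝟙 S)
  {V : S.Opens} {U : W.Opens} (hUV : U ≤ π ⁻¹ᵁ V) (hVU : V ≤ τ ⁻¹ᵁ U)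

/-- The algebra of sections over an open subset lying over an open subset of the base. -/
@[reducible]
noncomputable def baseAlgebra : Algebra Γ(S, V) Γ(W, U) := (π.appLE V U hUV).hom.toAlgebra

include hτ in
lemma appLE_section (b : Γ(S, V)) : τ.appLE U V hVU (π.appLE V U hUV b) = b := by
  have h1 : (τ ≫ π).appLE V V (by rw [hτ]; exact le_rfl) = 𝟙 _ := by
    rw [show (τ ≫ π).appLE V V (by rw [hτ]; exact le_rfl) = (𝟙 S : S ⟶ S).appLE V V le_rfl by
      congr 1]
    exact ((𝟙 S : S ⟶ S).appLE_eq_app (U := V)).trans (Scheme.Hom.id_app V)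
  have h2 := Scheme.Hom.appLE_comp_appLE τ π V U V hUV hVU
  exact congr($(h2.trans h1) b)

/-- Restriction to a section, as a retraction of the structure homomorphism. -/
noncomputable def retraction :
    letI := baseAlgebra π hUV
    Γ(W, U) →ₐ[Γ(S, V)] Γ(S, V) :=
  letI := baseAlgebra π hUV
  { (τ.appLE U V hVU).hom with
    commutes' := fun b ↦ appLE_section π τ hτ hUV hVU b }

lemma sectionPoint_apply (s : S) : π.fiberι s (sectionPoint π τ hτ s) = τ s :=
  π.fiberι_fiberHomeo_symm _ _

lemma algebraMap_sectionsAlgebra {k : Type u} [CommRing k] {X : Scheme.{u}}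
    (p : X ⟶ Spec (.of k)) (O : X.Opens) (c : k) :
    (letI := sectionsAlgebra p O; algebraMap k Γ(X, O) c) =
      p.appLE ⊤ O le_top ((Scheme.ΓSpecIso (.of k)).inv c) := rfl

lemma finiteType_sectionsAlgebra {k : Type u} [CommRing k] {X : Scheme.{u}} (p : X ⟶ Spec (.of k))
    [LocallyOfFiniteType p]
    {O : X.Opens} (hO : IsAffineOpen O) :
    letI := sectionsAlgebra p O
    Algebra.FiniteType k Γ(X, O) := by
  let := sectionsAlgebra p O
  have h1 := p.finiteType_appLE (isAffineOpen_top _) hO le_top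
  have h2 : (algebraMap k Γ(X, O)).FiniteType :=
    h1.comp (.of_surjective _
      (ConcreteCategory.bijective_of_isIso (Scheme.ΓSpecIso (.of k)).inv).2)
  exact h2

variable {k : Type u} [Field k] [IsAlgClosed k] (pS : S ⟶ Spec (.of k))

/-- Zariski's lemma: the residue field is finite over k, hence equal to k. -/
lemma algebraMap_quotient_bijective {B : Type u} [CommRing B] [Algebra k B] [Algebra.FiniteType k B]
    (p : Ideal B) [p.IsMaximal] : Function.Bijective (algebraMap k (B ⧸ p)) := by
  let := Ideal.Quotient.field p
  have : Module.Finite k (B ⧸ p) := finite_of_finite_type_of_isJacobsonRing k (B ⧸ p)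
  exact IsAlgClosed.algebraMap_bijective_of_isIntegral

/-- The dimension of the fibre of the jet scheme of a fibre over the point of a section. -/
lemma topologicalKrullDim_fiber_sectionPoint (m : ℕ) [LocallyOfFiniteType pS]
    (hV : IsAffineOpen V) (hU : IsAffineOpen U) {s : S} (hs : IsClosed {s}) (hsV : s ∈ V) :
    letI := baseAlgebra π hUV
    topologicalKrullDim ((jetProj (fiberStructure pS π s) m).fiber (sectionPoint π τ hτ s)) =
      ringKrullDim (FiberRing (JetAlgebra.Based m (retraction π τ hτ hUV hVU))
        (hV.primeIdealOf ⟨s, hsV⟩).asIdeal) := by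
  let := baseAlgebra π hUV
  let := sectionsAlgebra pS V
  let e := retraction π τ hτ hUV hVU
  let x := sectionPoint π τ hτ s
  let U' := π.fiberι s ⁻¹ᵁ U
  have hU' : IsAffineOpen U' := isAffineOpen_fiberι_preimage π hs hU
  have hιx : π.fiberι s x = τ s := sectionPoint_apply π τ hτ s
  have hsU : τ s ∈ U := hVU hsV
  have hx : x ∈ U' := by
    change π.fiberι s x ∈ U
    rwa [hιx]
  let ρ := ((π.fiberι s).app U).hom
  have hρ : Function.Surjective ρ := fiberι_app_surjective π hs hU
  have hker := ker_fiberι_app π hs hV hsV hU hUV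
  have hm := hV.primeIdealOf_isMaximal_of_isClosed ⟨s, hsV⟩ hs
  let M := (hV.primeIdealOf ⟨s, hsV⟩).asIdeal
  let P := (hU'.primeIdealOf ⟨x, hx⟩).asIdeal
  -- Both sides are the prime of τ(s) in U, reached through the fibre and through the section.
  have hcomap : P.comap ρ = M.comap e.toRingHom := by
    have h1 := congr_arg PrimeSpectrum.asIdeal
      (IsAffineOpen.comap_primeIdealOf_appLE (f := π.fiberι s) U hU U' hU' le_rfl hx)
    have h2 := congr_arg PrimeSpectrum.asIdeal
      (IsAffineOpen.comap_primeIdealOf_appLE (f := τ) U hU V hV hVU hsV)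
    have h3 : hU.primeIdealOf ⟨π.fiberι s x, hx⟩ = hU.primeIdealOf ⟨τ s, hVU hsV⟩ := by
      congr 1
      exact Subtype.ext hιx
    rw [h3, ← h2, PrimeSpectrum.comap_asIdeal, PrimeSpectrum.comap_asIdeal,
      Scheme.Hom.appLE_eq_app] at h1
    exact h1
  -- If e(r) ∈ M, then ρ kills the scalar e(r), so r may be replaced by r - e(r), which lies in ker
  -- e.
  have hP : P = (RingHom.ker e).map ρ := by
    apply le_antisymm
    · intro a ha
      obtain ⟨r, rfl⟩ := hρ a
      have hr : e r ∈ M := by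
        have : r ∈ P.comap ρ := ha
        rwa [hcomap] at this
      have h1 : ρ (algebraMap _ _ (e r)) = 0 := by
        have := Ideal.mem_map_of_mem (π.appLE V U hUV).hom hr
        rwa [← hker] at this
      have h2 : ρ r = ρ (r - algebraMap _ _ (e r)) := by rw [map_sub, h1, sub_zero]
      rw [h2]
      refine Ideal.mem_map_of_mem _ ?_
      rw [RingHom.mem_ker, map_sub, AlgHom.commutes, Algebra.algebraMap_self_apply, sub_self]
    · rw [Ideal.map_le_iff_le_comap, hcomap]
      intro r hr
      change e r ∈ M
      rw [show e r = 0 from hr]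
      exact zero_mem _
  have he : Function.Surjective e.toRingHom := fun b ↦ ⟨algebraMap _ _ b, e.commutes b⟩
  have hPmax : P.IsMaximal := by
    have h1 : (M.comap e.toRingHom).IsMaximal := Ideal.comap_isMaximal_of_surjective _ he (H := hm)
    have h2 : (P.comap ρ).map ρ = P := Ideal.map_comap_of_surjective _ hρ P
    rw [hcomap] at h2
    rw [← h2]
    refine (Ideal.map_eq_top_or_isMaximal_of_surjective _ hρ h1).resolve_left ?_
    rw [h2]
    exact (hU'.primeIdealOf ⟨x, hx⟩).2.ne_top
  have h := topologicalKrullDim_fiber_jetProj (fiberStructure pS π s) m hU' hx hPmax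
  refine h.trans ?_
  let := sectionsAlgebra (fiberStructure pS π s) U'
  change ringKrullDim (JetAlgebra k Γ(π.fiber s, U') m ⧸ P.map (JetAlgebra.base k _ m)) = _
  rw [hP]
  have := finiteType_sectionsAlgebra pS hV
  refine JetAlgebra.ringKrullDim_quotient_map_base m e (algebraMap_quotient_bijective M) hρ hker ?_
  intro c
  rw [algebraMap_sectionsAlgebra, algebraMap_sectionsAlgebra]
  have h1 := Scheme.Hom.appLE_comp_appLE π pS ⊤ V U le_top hUV
  have h2 := Scheme.Hom.appLE_comp_appLE (π.fiberι s) (π ≫ pS) ⊤ U U' le_top le_rfl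
  rw [← h1, Scheme.Hom.appLE_eq_app] at h2
  exact congr($h2 _)

end SectionPoint

end AlgebraicGeometry.Scheme

/-! ### Adapted affine neighbourhoods and the theorem -/

lemma AlgebraicGeometry.Scheme.exists_affineOpens_of_section {S W : Scheme.{u}} (π : W ⟶ S)
    (τ : S ⟶ W) (hτ : τ ≫ π = 𝟙 S) (s : S) :
    ∃ (V : S.Opens) (U : W.Opens), IsAffineOpen V ∧ IsAffineOpen U ∧ s ∈ V ∧
      U ≤ π ⁻¹ᵁ V ∧ V ≤ τ ⁻¹ᵁ U := by
  have hπτ : ∀ t, π (τ t) = t := fun t ↦ by rw [← Scheme.Hom.comp_apply, hτ]; rfl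
  obtain ⟨V₀, hV₀, hsV₀, -⟩ := TopologicalSpace.Opens.isBasis_iff_nbhd.1 S.isBasis_affineOpens
    (show s ∈ (⊤ : S.Opens) from trivial)
  obtain ⟨U₀, hU₀, hsU₀, hUV₀⟩ := TopologicalSpace.Opens.isBasis_iff_nbhd.1 W.isBasis_affineOpens
    (show τ s ∈ π ⁻¹ᵁ V₀ by change π (τ s) ∈ V₀; rwa [hπτ])
  obtain ⟨b, hb, hsb⟩ := IsAffineOpen.exists_basicOpen_le hV₀ (V := τ ⁻¹ᵁ U₀) ⟨s, hsU₀⟩ hsV₀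
  -- Localizing both sides at the same b makes U equal to U₀ ∩ π⁻¹(V), which still contains τ(V)
  -- because π ∘ τ is the identity.
  refine ⟨S.basicOpen b, W.basicOpen (π.appLE V₀ U₀ hUV₀ b), IsAffineOpen.basicOpen hV₀ b,
    IsAffineOpen.basicOpen hU₀ _, hsb, ?_, ?_⟩
  · rw [Scheme.basicOpen_appLE]
    exact inf_le_right
  · rw [Scheme.basicOpen_appLE]
    intro t ht
    refine ⟨hb ht, ?_⟩
    change π (τ t) ∈ S.basicOpen b
    rwa [hπτ]

lemma AlgebraicGeometry.IsAffineOpen.mem_basicOpen_iff_notMem_primeIdealOf {X : Scheme.{u}}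
    {U : X.Opens} (hU : IsAffineOpen U) {x : X} (hx : x ∈ U) (f : Γ(X, U)) :
    x ∈ X.basicOpen f ↔ f ∉ (hU.primeIdealOf ⟨x, hx⟩).asIdeal := by
  have h : hU.fromSpec (hU.primeIdealOf ⟨x, hx⟩) ∈ X.basicOpen f ↔
      hU.primeIdealOf ⟨x, hx⟩ ∈ PrimeSpectrum.basicOpen f := by
    rw [← hU.fromSpec_preimage_basicOpen]
    rfl
  rw [hU.fromSpec_primeIdealOf] at h
  exact h

theorem mainTheorem11 (S W : Scheme.{0}) (pS : S ⟶ Spec (.of ℂ)) (π : W ⟶ S) (τ : S ⟶ W)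
    (hτ : τ ≫ π = 𝟙 S)
    [LocallyOfFiniteType pS] [QuasiCompact pS]
    [LocallyOfFiniteType (π ≫ pS)] [QuasiCompact (π ≫ pS)]
    (m : ℕ) (hm : 1 ≤ m) :
    UpperSemicontinuous (fun s : closedPoints S ↦
      topologicalKrullDim ((Scheme.jetProj (Scheme.fiberStructure pS π s.1) m).fiber
        (Scheme.sectionPoint π τ hτ s.1))) := by
  intro s₀ y hy
  obtain ⟨V, U, hV, hU, hsV, hUV, hVU⟩ := Scheme.exists_affineOpens_of_section π τ hτ s₀.1
  let := Scheme.baseAlgebra π hUV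
  let := Scheme.sectionsAlgebra pS V
  let := Scheme.sectionsAlgebra (π ≫ pS) U
  have := Scheme.finiteType_sectionsAlgebra pS hV
  have := Scheme.finiteType_sectionsAlgebra (π ≫ pS) hU
  have : IsScalarTower ℂ Γ(S, V) Γ(W, U) := .of_algebraMap_eq fun c ↦ by
    rw [Scheme.algebraMap_sectionsAlgebra, Scheme.algebraMap_sectionsAlgebra]
    exact congr($((Scheme.Hom.appLE_comp_appLE π pS ⊤ V U le_top hUV).symm) _)
  have : Algebra.FiniteType Γ(S, V) Γ(W, U) :=
    Algebra.FiniteType.of_restrictScalars_finiteType ℂ Γ(S, V) Γ(W, U)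
  have hmax : ∀ s : closedPoints S, ∀ hs : s.1 ∈ V, (hV.primeIdealOf ⟨s.1, hs⟩).asIdeal.IsMaximal :=
    fun s hs ↦ hV.primeIdealOf_isMaximal_of_isClosed ⟨s.1, hs⟩ s.2
  have := hmax s₀ hsV
  -- The residue field contains ℂ; an infinite field is needed for the linear Noether normalization.
  have : Infinite (Γ(S, V) ⧸ (hV.primeIdealOf ⟨s₀.1, hsV⟩).asIdeal) :=
    .of_injective _ (Scheme.algebraMap_quotient_bijective (k := ℂ) _).1
  obtain ⟨b, hb, hle⟩ := JetAlgebra.exists_forall_ringKrullDim_based_le m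
    (Scheme.retraction π τ hτ hUV hVU) (hV.primeIdealOf ⟨s₀.1, hsV⟩).asIdeal
  have hopen : IsOpen {s : closedPoints S | s.1 ∈ S.basicOpen b} :=
    (S.basicOpen b).2.preimage continuous_subtype_val
  filter_upwards [hopen.mem_nhds ((hV.mem_basicOpen_iff_notMem_primeIdealOf hsV b).2 hb)] with s hs
  have hs' : s.1 ∈ V := S.basicOpen_le b hs
  refine lt_of_le_of_lt ?_ hy
  simp only
  rw [Scheme.topologicalKrullDim_fiber_sectionPoint π τ hτ hUV hVU pS m hV hU s.2 hs',
    Scheme.topologicalKrullDim_fiber_sectionPoint π τ hτ hUV hVU pS m hV hU s₀.2 hsV]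
  exact hle _ (hmax s hs') ((hV.mem_basicOpen_iff_notMem_primeIdealOf hs' b).1 hs)
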